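/- Let $N\ge 1$. Consider $N$ plane non-magnetic layers, numbered $1,\dots,N$, with thicknesses $d_j>0$, between two half-spaces (media $0$ and $N+1$) with constant refractive indices $n_0,n_{N+1}>0$ (for instance vacuum, $n_0=n_{N+1}=1$), at normal incidence. The layers are Lorentz-dispersive: $$n_j^2(\omega)=1+\frac{f_j}{\omega_j^2-\omega^2-i\Gamma_j\omega},\qquad 1\le j\le N,$$ with $\omega_j>0$, $f_j>0$, $\Gamma_j\ge 0$. Let $c>0$ be the speed of light, $\delta_m=n_m d_m\omega/c$, and $g_m=n_m$ (TE polarization) or $g_m=1/n_m$ (TM polarization). The numerator $Z_m$ and the denominator $N_m$ of the reflection coefficient for $m$ interfaces are given by Wolter's recursion: $Z_1=g_1-g_0$, $N_1=g_1+g_0$, and for $m\ge 2$ $$Z_m=(g_m-g_{m-1})e^{-i\delta_{m-1}}N_{m-1}+(g_m+g_{m-1})e^{i\delta_{m-1}}Z_{m-1},$$ $$N_m=(g_m+g_{m-1})e^{-i\delta_{m-1}}N_{m-1}+(g_m-g_{m-1})e^{i\delta_{m-1}}Z_{m-1}.$$ The denominator of the reflection and transmission coefficients of the medium is $\mathcal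 N=N_{N+1}$, regarded as a function of $\omega$. A natural mode frequency is a zero $\omega$ of $\mathcal N$ at which all $n_j$ are finite and nonzero. A resonance of layer $j$ is a root $a\in\mathbb C$ of $\omega_j^2-a^2-i\Gamma_j a=0$. (Each $n_j(\omega)$, $1\le j\le N$, is determined only up to sign, and $\mathcal N$ changes at most its sign with the choice; hence $\mathcal N^2$ and the natural mode frequencies do not depend on the choice.) Then, for TE and for TM polarization, at every resonance $a$ of every layer: 1. $a$ is an essential singularity of the denominator: the single-valued function $\mathcal N^2$ has an isolated essential singularity at $\omega=a$; moreover, in the local coordinate $t$ given by $\omega=a+t^2$ all the $n_j$ have holomorphic branches in a punctured neighbourhood of $t=0$, and for every such choice of branches $\mathcal N$ itself has an isolated essential singularity at $t=0$. 2. Every neighbourhood of $a$ contains infinitely many natural mode frequencies. At every point of $\mathbb C$ that is not a resonance of any layer, $\mathcal N^2$ is meromorphic, so it has no other essential singularities in $\mathbb C$. -/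

import Mathlib

open Filter Topology

noncomputable section

/-- A stratified medium of `N` plane, non-magnetic, Lorentz-dispersive layers, numbered `1, …, N`,
between two half-spaces (media `0` and `N + 1`) with constant refractive indices `nIn`, `nOut`.
Only the values of the layer parameters at `1 ≤ j ≤ N` play a role. -/
structure LorentzStack where
  /-- number of layers -/
  N : ℕ
  /-- speed of light -/
  c : ℝ
  /-- refractive index of medium `0` -/
  nIn : ℝ
  /-- refractive index of medium `N + 1` -/
  nOut : ℝ
  /-- characteristic frequencies -/
  charFreq : ℕ → ℝ
  /-- oscillator strengths -/
  strength : ℕ → ℝ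
  /-- damping coefficients -/
  damping : ℕ → ℝ
  /-- layer thicknesses -/
  thickness : ℕ → ℝ
  c_pos : 0 < c
  nIn_pos : 0 < nIn
  nOut_pos : 0 < nOut
  charFreq_pos : ∀ j, 1 ≤ j → j ≤ N → 0 < charFreq j
  strength_pos : ∀ j, 1 ≤ j → j ≤ N → 0 < strength j
  damping_nonneg : ∀ j, 1 ≤ j → j ≤ N → 0 ≤ damping j
  thickness_pos : ∀ j, 1 ≤ j → j ≤ N → 0 < thickness j

/-- The two polarizations. -/
inductive Polarization where
  | TE
  | TM

/-- Wolter's recursion: `wolter g δ k = (Z_{k+1}, N_{k+1})`, the numerator and the denominator of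
the reflection coefficient of a system with `k + 1` interfaces. -/
def wolter (g δ : ℕ → ℂ) : ℕ → ℂ × ℂ
  | 0 => (g 1 - g 0, g 1 + g 0)
  | k + 1 =>
    ((g (k + 2) - g (k + 1)) * Complex.exp (-Complex.I * δ (k + 1)) * (wolter g δ k).2
        + (g (k + 2) + g (k + 1)) * Complex.exp (Complex.I * δ (k + 1)) * (wolter g δ k).1,
      (g (k + 2) + g (k + 1)) * Complex.exp (-Complex.I * δ (k + 1)) * (wolter g δ k).2
        + (g (k + 2) - g (k + 1)) * Complex.exp (Complex.I * δ (k + 1)) * (wolter g δ k).1)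

/-- The coefficients `g_m` at normal incidence for `μ_m = 1`. -/
def Polarization.coeff : Polarization → (ℕ → ℂ) → ℕ → ℂ
  | .TE, n, m => n m
  | .TM, n, m => 1 / n m

namespace LorentzStack

/-- `ω_j² - ω² - i Γ_j ω`. -/
def lorentzDenom (S : LorentzStack) (j : ℕ) (ω : ℂ) : ℂ :=
  (S.charFreq j : ℂ) ^ 2 - ω ^ 2 - Complex.I * (S.damping j : ℂ) * ω

/-- `ω` is a resonance of layer `j`, i.e. a singularity of its refractive index. -/
def IsResonance (S : LorentzStack) (j : ℕ) (ω : ℂ) : Prop :=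
  1 ≤ j ∧ j ≤ S.N ∧ S.lorentzDenom j ω = 0

/-- The numbers `n 0, …, n (N + 1)` are admissible values at frequency `ω` of the refractive
indices of the media. In the layers the dispersion relation fixes `n j` up to sign; at a resonance
of layer `j` the index of that layer has no value and nothing is asked of `n j`. -/
structure IsIndexAt (S : LorentzStack) (ω : ℂ) (n : ℕ → ℂ) : Prop where
  left : n 0 = (S.nIn : ℂ)
  right : n (S.N + 1) = (S.nOut : ℂ)
  layer : ∀ j, 1 ≤ j → j ≤ S.N → S.lorentzDenom j ω ≠ 0 →
    n j ^ 2 = 1 + (S.strength j : ℂ) / S.lorentzDenom j ω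

/-- The phases `δ_m = n_m d_m ω / c`. -/
def phase (S : LorentzStack) (ω : ℂ) (n : ℕ → ℂ) (m : ℕ) : ℂ :=
  n m * (S.thickness m : ℂ) * ω / (S.c : ℂ)

/-- The common denominator `N_{N+1}` of the reflection and the transmission coefficient of the
stack (which has `N + 1` interfaces) at frequency `ω`, for the values `n` of the indices. -/
def denominator (S : LorentzStack) (p : Polarization) (ω : ℂ) (n : ℕ → ℂ) : ℂ :=
  (wolter (p.coeff n) (S.phase ω n) S.N).2

/-- `ω` is a natural mode frequency: all indices are finite and nonzero at `ω`, and the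
denominator vanishes there. -/
def IsNaturalMode (S : LorentzStack) (p : Polarization) (n : ℂ → ℕ → ℂ) (ω : ℂ) : Prop :=
  (∀ j, 1 ≤ j → j ≤ S.N → S.lorentzDenom j ω ≠ 0 ∧ n ω j ≠ 0) ∧ S.denominator p ω (n ω) = 0

/-- `ν` is a choice of the refractive indices near `a`, written in the local coordinate `t` with
`ω = a + t²`, that is holomorphic in a punctured neighbourhood of `t = 0`. -/
def IsHolomorphicBranch (S : LorentzStack) (a : ℂ) (ν : ℂ → ℕ → ℂ) : Prop :=
  ∀ᶠ t in 𝓝[≠] (0 : ℂ), S.IsIndexAt (a + t ^ 2) (ν t) ∧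
    ∀ j, 1 ≤ j → j ≤ S.N → AnalyticAt ℂ (fun s => ν s j) t

end LorentzStack

/-- `a` is an (isolated) essential singularity of `f`: `f` is holomorphic in a punctured
neighbourhood of `a`, and `a` is neither a removable singularity nor a pole. -/
def IsEssentialSingularity (f : ℂ → ℂ) (a : ℂ) : Prop :=
  (∀ᶠ z in 𝓝[≠] a, AnalyticAt ℂ f z) ∧ ¬ MeromorphicAt f a

end

/-!
Once the denominator is written as `2 ^ N ∏ g_j` times a reduced denominator, the latter is
single-valued: the characteristic matrix of a layer is an entire function of `n_j²` and `ω`, and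
`n_j²` is a rational function of `ω`. The claims thus concern the reduced denominator near a pole
`a` of some `n_j²`.

Along a generic ray into `a` the phases of all layers resonant at `a` acquire imaginary parts that
grow like a power of the inverse distance. With the roots chosen to decay, each such layer
multiplies the field by an exponentially large factor and by an interface factor, which depends on
the adjacent block of nonresonant layers. The interface factors are bounded below by a power of the
distance: up to polynomially bounded terms they divide a meromorphic function of `ω`, and this
function does not vanish identically because on the imaginary axis all `n_j²` are positive and all
layers are evanescent. Hence the reduced denominator grows faster than any power along the ray,
which excludes a pole.

On the other hand it is bounded by `exp (C / |ω - a|)`. If it had no zeros near `a`, then by the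
Borel–Carathéodory inequality its logarithmic derivative would have at most a double pole at `a`,
so that the product of its values at `a + x v` and `a - x v` would grow only polynomially in
`1 / x`. This contradicts the growth along the two opposite rays.
-/

open Asymptotics Matrix

section Asymptotics

variable {ι 𝕜 : Type*} [NormedField 𝕜] {l : Filter ι} {k f g : ι → 𝕜}

/-- `f` grows at most polynomially in the parameter `k` along `l`. The bound is by powers of
`1 + ‖k‖` so that `k` need not tend to infinity. -/
def PolyBdd (l : Filter ι) (k f : ι → 𝕜) : Prop :=
  ∃ m : ℕ, f =O[l] fun i => (1 + ‖k i‖) ^ m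

/-- `f` is eventually nonzero along `l` and its inverse grows at most polynomially in `k`. -/
structure PolyInv (l : Filter ι) (k f : ι → 𝕜) : Prop where
  ne_zero : ∀ᶠ i in l, f i ≠ 0
  polyBdd_inv : PolyBdd l k fun i => (f i)⁻¹

theorem isBigO_one_add_norm_pow (l : Filter ι) (k : ι → 𝕜) {m n : ℕ} (h : m ≤ n) :
    (fun i => (1 + ‖k i‖) ^ m) =O[l] fun i => (1 + ‖k i‖) ^ n := by
  refine IsBigO.of_norm_le fun i => ?_
  rw [Real.norm_of_nonneg (by positivity)]
  exact pow_le_pow_right₀ (by linarith [norm_nonneg (k i)]) h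

theorem PolyBdd.congr' (hf : PolyBdd l k f) (h : f =ᶠ[l] g) : PolyBdd l k g := by
  obtain ⟨m, hm⟩ := hf
  exact ⟨m, hm.congr' h .rfl⟩

theorem polyBdd_of_isBigO_one (h : f =O[l] fun _ => (1 : ℝ)) : PolyBdd l k f :=
  ⟨0, by simpa only [pow_zero] using h⟩

theorem polyBdd_of_tendsto {c : 𝕜} (h : Tendsto f l (𝓝 c)) : PolyBdd l k f :=
  polyBdd_of_isBigO_one (h.isBigO_one ℝ)

theorem polyBdd_const (c : 𝕜) : PolyBdd l k fun _ => c :=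
  polyBdd_of_isBigO_one (isBigO_const_const c one_ne_zero l)

theorem polyBdd_param : PolyBdd l k k :=
  ⟨1, IsBigO.of_norm_le fun i => by linarith⟩

namespace PolyBdd

theorem add (hf : PolyBdd l k f) (hg : PolyBdd l k g) : PolyBdd l k fun i => f i + g i := by
  obtain ⟨m, hm⟩ := hf
  obtain ⟨n, hn⟩ := hg
  exact ⟨m + n, (hm.trans (isBigO_one_add_norm_pow l k (by lia))).add
    (hn.trans (isBigO_one_add_norm_pow l k (by lia)))⟩

theorem mul (hf : PolyBdd l k f) (hg : PolyBdd l k g) : PolyBdd l k fun i => f i * g i := by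
  obtain ⟨m, hm⟩ := hf
  obtain ⟨n, hn⟩ := hg
  exact ⟨m + n, by simpa only [pow_add] using hm.mul hn⟩

theorem pow (hf : PolyBdd l k f) (n : ℕ) : PolyBdd l k fun i => f i ^ n := by
  obtain ⟨m, hm⟩ := hf
  exact ⟨m * n, by simpa only [pow_mul] using hm.pow n⟩

theorem neg (hf : PolyBdd l k f) : PolyBdd l k fun i => -f i := by
  obtain ⟨m, hm⟩ := hf
  exact ⟨m, hm.neg_left⟩

theorem sub (hf : PolyBdd l k f) (hg : PolyBdd l k g) : PolyBdd l k fun i => f i - g i := by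
  simpa only [sub_eq_add_neg] using hf.add hg.neg

theorem of_sq (hf : PolyBdd l k fun i => f i ^ 2) : PolyBdd l k f := by
  obtain ⟨m, hm⟩ := hf
  have hle : f =O[l] fun i => 1 + ‖f i ^ 2‖ := by
    refine IsBigO.of_norm_le fun i => ?_
    rw [norm_pow]
    nlinarith [sq_nonneg (‖f i‖ - 1), norm_nonneg (f i)]
  refine ⟨m, hle.trans (IsBigO.add ?_ hm.norm_left)⟩
  simpa only [pow_zero] using isBigO_one_add_norm_pow l k (Nat.zero_le m)

theorem comp {κ : Type*} {l' : Filter κ} (hf : PolyBdd l k f) {u : κ → ι} (hu : Tendsto u l' l) :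
    PolyBdd l' (fun j => k (u j)) fun j => f (u j) := by
  obtain ⟨m, hm⟩ := hf
  exact ⟨m, hm.comp_tendsto hu⟩

theorem mono_param {k' : ι → 𝕜} (hf : PolyBdd l k f) (hk : PolyBdd l k' k) : PolyBdd l k' f := by
  obtain ⟨m, hm⟩ := hf
  obtain ⟨n, hn⟩ := hk
  refine ⟨n * m, hm.trans ?_⟩
  simp only [pow_mul]
  refine IsBigO.pow (IsBigO.add ?_ hn.norm_left) m
  simpa only [pow_zero] using isBigO_one_add_norm_pow l k' (Nat.zero_le n)

end PolyBdd

theorem tendsto_zero_of_superpolynomialDecay (hf : SuperpolynomialDecay l k f) :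
    Tendsto f l (𝓝 0) := by
  simpa only [pow_zero, one_mul] using hf 0

theorem polyBdd_of_superpolynomialDecay (hf : SuperpolynomialDecay l k f) : PolyBdd l k f :=
  polyBdd_of_tendsto (tendsto_zero_of_superpolynomialDecay hf)

theorem PolyBdd.mul_superpolynomialDecay (hf : PolyBdd l k f) (hg : SuperpolynomialDecay l k g) :
    SuperpolynomialDecay l k fun i => f i * g i := by
  obtain ⟨m, hm⟩ := hf
  intro n
  have hpow : (fun i => (1 + ‖k i‖) ^ m) =O[l] fun i => 1 + ‖k i ^ m‖ := by
    refine IsBigO.of_bound (2 ^ (m - 1)) (.of_forall fun i => ?_)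
    simp only [norm_pow, Real.norm_of_nonneg (by positivity : 0 ≤ 1 + ‖k i‖),
      Real.norm_of_nonneg (by positivity : 0 ≤ 1 + ‖k i‖ ^ m)]
    simpa only [one_pow] using add_pow_le zero_le_one (norm_nonneg (k i)) m
  have hdom : (fun i => k i ^ n * (f i * g i)) =O[l]
      fun i => (1 + ‖k i ^ m‖) * ‖k i ^ n * g i‖ := by
    refine ((hm.trans hpow).mul (isBigO_refl (fun i => k i ^ n * g i) l).norm_right).congr_left
      fun i => by ring
  refine hdom.trans_tendsto ?_
  simpa only [norm_zero, add_zero, add_mul, one_mul, ← norm_mul, ← mul_assoc, ← pow_add] using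
    (hg n).norm.add (hg (m + n)).norm

theorem polyInv_const {c : 𝕜} (hc : c ≠ 0) : PolyInv l k fun _ => c :=
  ⟨.of_forall fun _ => hc, polyBdd_const _⟩

theorem polyInv_of_tendsto {c : 𝕜} (hc : c ≠ 0) (h : Tendsto f l (𝓝 c)) : PolyInv l k f :=
  ⟨h.eventually_ne hc, polyBdd_of_tendsto (h.inv₀ hc)⟩

theorem polyInv_of_le_norm {r : ℝ} (hr : 0 < r) (h : ∀ᶠ i in l, r ≤ ‖f i‖) : PolyInv l k f where
  ne_zero := h.mono fun _ hi => norm_pos_iff.1 (hr.trans_le hi)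
  polyBdd_inv := polyBdd_of_isBigO_one (IsBigO.of_bound r⁻¹ (h.mono fun i hi => by
    rw [norm_inv, norm_one, mul_one]
    exact inv_anti₀ hr hi))

namespace PolyInv

theorem congr' (hf : PolyInv l k f) (h : f =ᶠ[l] g) : PolyInv l k g where
  ne_zero := by
    filter_upwards [hf.ne_zero, h] with i hi hfg
    rwa [← hfg]
  polyBdd_inv := hf.polyBdd_inv.congr' h.inv

theorem mul (hf : PolyInv l k f) (hg : PolyInv l k g) : PolyInv l k fun i => f i * g i where
  ne_zero := hf.ne_zero.mp (hg.ne_zero.mono fun _ h₁ h₂ => mul_ne_zero h₂ h₁)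
  polyBdd_inv := by simpa only [mul_inv] using hf.polyBdd_inv.mul hg.polyBdd_inv

theorem inv (hf : PolyBdd l k f) (h0 : ∀ᶠ i in l, f i ≠ 0) : PolyInv l k fun i => (f i)⁻¹ :=
  ⟨h0.mono fun _ h => inv_ne_zero h, by simpa only [inv_inv] using hf⟩

theorem of_mul_left (h : PolyInv l k fun i => f i * g i) (hg : PolyBdd l k g) : PolyInv l k f := by
  refine ⟨h.ne_zero.mono fun i => left_ne_zero_of_mul, (h.polyBdd_inv.mul hg).congr' ?_⟩
  filter_upwards [h.ne_zero] with i hi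
  rw [mul_inv, mul_assoc, inv_mul_cancel₀ (right_ne_zero_of_mul hi), mul_one]

theorem add_superpolynomialDecay (hf : PolyInv l k f) (hg : SuperpolynomialDecay l k g) :
    PolyInv l k fun i => f i + g i := by
  have hlim : Tendsto (fun i => 1 + (f i)⁻¹ * g i) l (𝓝 1) := by
    simpa only [add_zero] using
      (tendsto_zero_of_superpolynomialDecay
        (hf.polyBdd_inv.mul_superpolynomialDecay hg)).const_add 1
  refine (hf.mul (polyInv_of_tendsto one_ne_zero hlim)).congr' ?_
  filter_upwards [hf.ne_zero] with i hi
  rw [mul_add, mul_one, mul_inv_cancel_left₀ hi]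

end PolyInv

theorem superpolynomialDecay_cexp {k δ : ι → ℂ} {c : ℝ} (hc : 0 < c)
    (hk : Tendsto (fun i => ‖k i‖) l atTop) (hpos : ∀ᶠ i in l, 0 ≤ (δ i).im)
    (h : ∀ᶠ i in l, c * ‖k i‖ ≤ (δ i).im ^ 2) :
    SuperpolynomialDecay l k fun i => Complex.exp (Complex.I * δ i) := by
  have him : Tendsto (fun i => (δ i).im) l atTop := by
    refine tendsto_atTop_mono' l ?_ (Real.tendsto_sqrt_atTop.comp (hk.const_mul_atTop hc))
    filter_upwards [hpos, h] with i h0 hi using Real.sqrt_le_iff.2 ⟨h0, hi⟩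
  intro n
  have hlim := ((Real.tendsto_pow_mul_exp_neg_atTop_nhds_zero (2 * n)).comp him).const_mul (c⁻¹ ^ n)
  refine squeeze_zero_norm' ?_ (by simpa only [mul_zero] using hlim)
  filter_upwards [h] with i hi
  have hnorm : ‖Complex.exp (Complex.I * δ i)‖ = Real.exp (-(δ i).im) := by
    simp [Complex.norm_exp]
  calc ‖k i ^ n * Complex.exp (Complex.I * δ i)‖
      = ‖k i‖ ^ n * Real.exp (-(δ i).im) := by rw [norm_mul, norm_pow, hnorm]
    _ ≤ (c⁻¹ * (δ i).im ^ 2) ^ n * Real.exp (-(δ i).im) := by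
        gcongr
        rwa [inv_mul_eq_div, le_div_iff₀' hc]
    _ = _ := by simp only [Function.comp_apply, mul_pow, ← pow_mul, mul_assoc]

end Asymptotics

/-- The characteristic matrix of a layer with coefficient `g` and phase `δ`. -/
noncomputable def layerMatrix (g δ : ℂ) : Matrix (Fin 2) (Fin 2) ℂ :=
  !![Complex.cos δ, -Complex.I * (Complex.sin δ / g);
    -Complex.I * (g * Complex.sin δ), Complex.cos δ]

/-- The amplitude with which a layer transmits the component of `v` along the eigenvector `(1, g)`
of its characteristic matrix, which is the growing one if `0 < Im δ`. -/
noncomputable def layerGain (g δ : ℂ) (v : Fin 2 → ℂ) : ℂ :=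
  Complex.exp (-(Complex.I * δ)) / 2 * (v 0 + v 1 * g⁻¹)

theorem layerMatrix_mulVec {g : ℂ} (hg : g ≠ 0) (δ : ℂ) (v : Fin 2 → ℂ) :
    layerMatrix g δ *ᵥ v = layerGain g δ v • ![1, g] + layerGain (-g) (-δ) v • ![1, -g] := by
  have hpos : Complex.exp (Complex.I * δ) = Complex.cos δ + Complex.sin δ * Complex.I := by
    rw [mul_comm, Complex.exp_mul_I]
  have hneg : Complex.exp (-(Complex.I * δ)) = Complex.cos δ - Complex.sin δ * Complex.I := by
    rw [← mul_neg, mul_comm, Complex.exp_mul_I, Complex.cos_neg, Complex.sin_neg, neg_mul,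
      sub_eq_add_neg]
  simp only [layerGain, mul_neg, neg_neg, hpos, hneg]
  ext a
  fin_cases a <;>
    simp only [layerMatrix, Matrix.mulVec, dotProduct, Fin.sum_univ_two, Matrix.of_apply,
      Matrix.cons_val, Pi.add_apply, Pi.smul_apply, smul_eq_mul, Fin.zero_eta, Fin.mk_one] <;>
    field_simp <;> ring

section AsympSMul

variable {ι : Type*} {l : Filter ι} {k A : ι → ℂ} {e v v' : ι → Fin 2 → ℂ} {g δ : ι → ℂ}

theorem superpolynomialDecay_inv_layerGain (hA : PolyInv l k A)
    (hδ : SuperpolynomialDecay l k fun i => Complex.exp (Complex.I * δ i))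
    (hB : PolyInv l k fun i => e i 0 + e i 1 * (g i)⁻¹) :
    SuperpolynomialDecay l k fun i => (A i * layerGain (g i) (δ i) (e i))⁻¹ := by
  refine (((polyBdd_const 2).mul (hA.mul hB).polyBdd_inv).mul_superpolynomialDecay hδ).congr
    fun i => ?_
  simp only [layerGain, mul_inv, div_eq_mul_inv, inv_inv, Complex.exp_neg]
  ring

/-- The vectors `v` agree with `A • e` up to a relative error that decays faster than any power of
the parameter `k`. -/
structure AsympSMul (l : Filter ι) (k A : ι → ℂ) (e v : ι → Fin 2 → ℂ) : Prop where
  polyInv : PolyInv l k A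
  decay : ∀ a, SuperpolynomialDecay l k fun i => (A i)⁻¹ * v i a - e i a

theorem asympSMul_refl (v : ι → Fin 2 → ℂ) : AsympSMul l k (fun _ => 1) v v where
  polyInv := polyInv_const one_ne_zero
  decay a := (superpolynomialDecay_zero l k).congr fun i => by simp

namespace AsympSMul

theorem congr' (h : AsympSMul l k A e v) (hv : v =ᶠ[l] v') : AsympSMul l k A e v' where
  polyInv := h.polyInv
  decay a := (h.decay a).congr' (hv.mono fun i hi => by simp only [hi])

theorem mulVec (h : AsympSMul l k A e v) {T : ι → Matrix (Fin 2) (Fin 2) ℂ}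
    (hT : ∀ a b, PolyBdd l k fun i => T i a b) :
    AsympSMul l k A (fun i => T i *ᵥ e i) (fun i => T i *ᵥ v i) where
  polyInv := h.polyInv
  decay a := by
    refine (((hT a 0).mul_superpolynomialDecay (h.decay 0)).add
      ((hT a 1).mul_superpolynomialDecay (h.decay 1))).congr fun i => ?_
    simp only [Matrix.mulVec, dotProduct, Fin.sum_univ_two, Pi.add_apply]
    ring

theorem polyBdd (h : AsympSMul l k A e v) (he : ∀ a, PolyBdd l k fun i => e i a) (a : Fin 2) :
    PolyBdd l k fun i => (A i)⁻¹ * v i a :=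
  ((he a).add (polyBdd_of_superpolynomialDecay (h.decay a))).congr'
    (.of_forall fun _ => add_sub_cancel _ _)

variable {c d : ι → ℂ}

theorem polyInv_inv_mul_linearCombination (h : AsympSMul l k A e v) (hc : PolyBdd l k c)
    (hd : PolyBdd l k d) (hB : PolyInv l k fun i => c i * e i 0 + d i * e i 1) :
    PolyInv l k fun i => (A i)⁻¹ * (c i * v i 0 + d i * v i 1) := by
  refine (hB.add_superpolynomialDecay ((hc.mul_superpolynomialDecay (h.decay 0)).add
    (hd.mul_superpolynomialDecay (h.decay 1)))).congr' (.of_forall fun i => ?_)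
  simp only [Pi.add_apply]
  ring

theorem polyInv_linearCombination (h : AsympSMul l k A e v) (hc : PolyBdd l k c)
    (hd : PolyBdd l k d) (hB : PolyInv l k fun i => c i * e i 0 + d i * e i 1) :
    PolyInv l k fun i => c i * v i 0 + d i * v i 1 :=
  (h.polyInv.mul (h.polyInv_inv_mul_linearCombination hc hd hB)).congr'
    (h.polyInv.ne_zero.mono fun _ hi => mul_inv_cancel_left₀ hi _)

theorem superpolynomialDecay_inv_linearCombination (h : AsympSMul l k A e v)
    (hA : SuperpolynomialDecay l k fun i => (A i)⁻¹) (hc : PolyBdd l k c)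
    (hd : PolyBdd l k d) (hB : PolyInv l k fun i => c i * e i 0 + d i * e i 1) :
    SuperpolynomialDecay l k fun i => (c i * v i 0 + d i * v i 1)⁻¹ := by
  have hinv := (h.polyInv_inv_mul_linearCombination hc hd hB).polyBdd_inv
  refine (hinv.mul_superpolynomialDecay hA).congr' ?_
  filter_upwards [h.polyInv.ne_zero] with i hi
  rw [mul_inv, inv_inv, mul_right_comm, mul_inv_cancel₀ hi, one_mul]

theorem superpolynomialDecay_layerGain_sub_one (h : AsympSMul l k A e v) (hg : PolyInv l k g)
    (hB : PolyInv l k fun i => e i 0 + e i 1 * (g i)⁻¹) :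
    SuperpolynomialDecay l k fun i =>
      (A i * layerGain (g i) (δ i) (e i))⁻¹ * layerGain (g i) (δ i) (v i) - 1 := by
  refine (hB.polyBdd_inv.mul_superpolynomialDecay
    ((h.decay 0).add (hg.polyBdd_inv.mul_superpolynomialDecay (h.decay 1)))).congr' ?_
  filter_upwards [h.polyInv.ne_zero, hg.ne_zero, hB.ne_zero] with i hAi hgi hBi
  have hexp := Complex.exp_ne_zero (-(Complex.I * δ i))
  simp only [layerGain, Pi.add_apply]
  have hnum : e i 0 * g i + e i 1 ≠ 0 := by
    field_simp at hBi
    exact (div_ne_zero_iff.1 hBi).1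
  field_simp
  ring

theorem superpolynomialDecay_layerGain_neg (h : AsympSMul l k A e v)
    (he : ∀ a, PolyBdd l k fun i => e i a) (hg : PolyInv l k g)
    (hδ : SuperpolynomialDecay l k fun i => Complex.exp (Complex.I * δ i))
    (hB : PolyInv l k fun i => e i 0 + e i 1 * (g i)⁻¹) :
    SuperpolynomialDecay l k fun i =>
      (A i * layerGain (g i) (δ i) (e i))⁻¹ * layerGain (-g i) (-δ i) (v i) := by
  refine ((hB.polyBdd_inv.mul ((h.polyBdd he 0).sub ((h.polyBdd he 1).mul hg.polyBdd_inv))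
    ).mul_superpolynomialDecay (hδ.mul hδ)).congr fun i => ?_
  simp only [layerGain, Pi.mul_apply, mul_neg, neg_neg, mul_inv, div_eq_mul_inv, inv_inv,
    Complex.exp_neg, inv_neg]
  ring

theorem layer (h : AsympSMul l k A e v) (he : ∀ a, PolyBdd l k fun i => e i a)
    (hg : PolyBdd l k g) (hg' : PolyInv l k g)
    (hδ : SuperpolynomialDecay l k fun i => Complex.exp (Complex.I * δ i))
    (hB : PolyInv l k fun i => e i 0 + e i 1 * (g i)⁻¹) :
    AsympSMul l k (fun i => A i * layerGain (g i) (δ i) (e i)) (fun i => ![1, g i])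
      (fun i => layerMatrix (g i) (δ i) *ᵥ v i) := by
  have hgrow := h.superpolynomialDecay_layerGain_sub_one (δ := δ) hg' hB
  have hdecay := h.superpolynomialDecay_layerGain_neg he hg' hδ hB
  refine ⟨⟨?_, polyBdd_of_superpolynomialDecay
    (superpolynomialDecay_inv_layerGain h.polyInv hδ hB)⟩, fun a => ?_⟩
  · filter_upwards [h.polyInv.ne_zero, hB.ne_zero] with i hA hB
    exact mul_ne_zero hA (mul_ne_zero (div_ne_zero (Complex.exp_ne_zero _) two_ne_zero) hB)
  · have hsum : SuperpolynomialDecay l k fun i => (![1, g i] a *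
          ((A i * layerGain (g i) (δ i) (e i))⁻¹ * layerGain (g i) (δ i) (v i) - 1) +
        ![1, -g i] a * ((A i * layerGain (g i) (δ i) (e i))⁻¹ *
          layerGain (-g i) (-δ i) (v i))) := by
      fin_cases a
      · exact (hgrow.add hdecay).congr fun i => by simp
      · exact (hg.mul_superpolynomialDecay hgrow).add (hg.neg.mul_superpolynomialDecay hdecay)
    refine hsum.congr' ?_
    filter_upwards [hg'.ne_zero] with i hgi
    rw [layerMatrix_mulVec hgi]
    simp only [Pi.add_apply, Pi.smul_apply, smul_eq_mul]
    ring

end AsympSMul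

end AsympSMul

/-- The product of the matrices `M m` over `j < m ≤ j + k`, with the last one leftmost: the
characteristic matrix of the layers `j + 1, …, j + k`. -/
noncomputable def stackMatrix (M : ℕ → Matrix (Fin 2) (Fin 2) ℂ) (j : ℕ) :
    ℕ → Matrix (Fin 2) (Fin 2) ℂ
  | 0 => 1
  | k + 1 => M (j + k + 1) * stackMatrix M j k

theorem stackMatrix_congr {M M' : ℕ → Matrix (Fin 2) (Fin 2) ℂ} {j k : ℕ}
    (h : ∀ m, j < m → m ≤ j + k → M m = M' m) : stackMatrix M j k = stackMatrix M' j k := by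
  induction k with
  | zero => rfl
  | succ k ih =>
    rw [stackMatrix, stackMatrix, h _ (by lia) (by lia), ih fun m h₁ h₂ => h m h₁ (by lia)]

theorem polyBdd_stackMatrix {ι : Type*} {l : Filter ι} {k : ι → ℂ}
    {M : ι → ℕ → Matrix (Fin 2) (Fin 2) ℂ} {j q : ℕ}
    (h : ∀ m, j < m → m ≤ j + q → ∀ a b, PolyBdd l k fun i => M i m a b) (a b : Fin 2) :
    PolyBdd l k fun i => stackMatrix (M i) j q a b := by
  induction q generalizing a with
  | zero => exact polyBdd_const _
  | succ q ih =>
    have hM := h (j + q + 1) (by lia) (by lia) a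
    have hstack := ih fun m h₁ h₂ => h m h₁ (by lia)
    simpa only [stackMatrix, Matrix.mul_apply, Fin.sum_univ_two] using
      ((hM 0).mul (hstack 0)).add ((hM 1).mul (hstack 1))

theorem analyticAt_stackMatrix {M : ℂ → ℕ → Matrix (Fin 2) (Fin 2) ℂ} {j q : ℕ} {ω : ℂ}
    (h : ∀ m, j < m → m ≤ j + q → ∀ a b, AnalyticAt ℂ (fun ω => M ω m a b) ω) (a b : Fin 2) :
    AnalyticAt ℂ (fun ω => stackMatrix (M ω) j q a b) ω := by
  induction q generalizing a with
  | zero => exact analyticAt_const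
  | succ q ih =>
    have hM := h (j + q + 1) (by lia) (by lia) a
    have hstack := ih fun m h₁ h₂ => h m h₁ (by lia)
    simp only [stackMatrix, Matrix.mul_apply, Fin.sum_univ_two]
    exact ((hM 0).mul (hstack 0)).add ((hM 1).mul (hstack 1))

/-- In terms of the fields `(N + Z, N - Z)`, Wolter's recursion is multiplication by the
characteristic matrices. -/
theorem wolter_eq_stackMatrix (g δ : ℕ → ℂ) (k : ℕ) (hg : ∀ m, 1 ≤ m → m ≤ k → g m ≠ 0) :
    (wolter g δ k).2 + (wolter g δ k).1 = 2 ^ (k + 1) * (∏ m ∈ Finset.Icc 1 k, g m) *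
        (g (k + 1) * (stackMatrix (fun m => layerMatrix (g m) (δ m)) 0 k *ᵥ ![1, g 0]) 0) ∧
      (wolter g δ k).2 - (wolter g δ k).1 = 2 ^ (k + 1) * (∏ m ∈ Finset.Icc 1 k, g m) *
        (stackMatrix (fun m => layerMatrix (g m) (δ m)) 0 k *ᵥ ![1, g 0]) 1 := by
  induction k with
  | zero =>
    simp only [wolter, stackMatrix, Finset.Icc_eq_empty_of_lt zero_lt_one, Finset.prod_empty,
      Matrix.one_mulVec, Matrix.cons_val_zero, Matrix.cons_val_one]
    constructor <;> ring
  | succ k ih =>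
    obtain ⟨hsum, hdiff⟩ := ih fun m h₁ h₂ => hg m h₁ (by lia)
    have hk := hg (k + 1) (by lia) le_rfl
    rw [stackMatrix, ← Matrix.mulVec_mulVec, zero_add, layerMatrix_mulVec hk,
      Finset.prod_Icc_succ_top (by lia)]
    set V := stackMatrix (fun m => layerMatrix (g m) (δ m)) 0 k *ᵥ ![1, g 0]
    set P := ∏ m ∈ Finset.Icc 1 k, g m
    have hden : (wolter g δ k).2 = 2 ^ k * P * (g (k + 1) * V 0 + V 1) := by
      rw [pow_succ] at hsum hdiff
      linear_combination (hsum + hdiff) / 2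
    have hnum : (wolter g δ k).1 = 2 ^ k * P * (g (k + 1) * V 0 - V 1) := by
      rw [pow_succ] at hsum hdiff
      linear_combination (hsum - hdiff) / 2
    simp only [wolter, hden, hnum, layerGain, Pi.add_apply, Pi.smul_apply, smul_eq_mul,
      Matrix.cons_val_zero, Matrix.cons_val_one, mul_neg, neg_neg, neg_mul]
    constructor <;> field_simp <;> ring

theorem wolter_snd_eq (g δ : ℕ → ℂ) (k : ℕ) (hg : ∀ m, 1 ≤ m → m ≤ k → g m ≠ 0) :
    (wolter g δ k).2 = 2 ^ k * (∏ m ∈ Finset.Icc 1 k, g m) *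
      (g (k + 1) * (stackMatrix (fun m => layerMatrix (g m) (δ m)) 0 k *ᵥ ![1, g 0]) 0 +
        (stackMatrix (fun m => layerMatrix (g m) (δ m)) 0 k *ᵥ ![1, g 0]) 1) := by
  obtain ⟨hsum, hdiff⟩ := wolter_eq_stackMatrix g δ k hg
  rw [pow_succ] at hsum hdiff
  linear_combination (hsum + hdiff) / 2

section EvenLift

/-- The function `h` with `h (z ^ 2) = f z`, for an even function `f`. -/
noncomputable def evenLift (f : ℂ → ℂ) (w : ℂ) : ℂ :=
  f (w ^ (2⁻¹ : ℂ))

theorem cpow_inv_two_sq (w : ℂ) : (w ^ (2⁻¹ : ℂ)) ^ 2 = w :=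
  Complex.cpow_nat_inv_pow w two_ne_zero

theorem evenLift_sq {f : ℂ → ℂ} (hf : ∀ z, f (-z) = f z) (z : ℂ) : evenLift f (z ^ 2) = f z := by
  rcases sq_eq_sq_iff_eq_or_eq_neg.1 (cpow_inv_two_sq (z ^ 2)) with h | h <;>
    simp only [evenLift, h, hf]

theorem exists_analyticAt_sq_eq {w₀ : ℂ} (hw : w₀ ≠ 0) :
    ∃ r : ℂ → ℂ, AnalyticAt ℂ r w₀ ∧ ∀ w, r w ^ 2 = w := by
  refine ⟨fun w => w₀ ^ (2⁻¹ : ℂ) * (w / w₀) ^ (2⁻¹ : ℂ), ?_, fun w => ?_⟩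
  · refine analyticAt_const.mul (AnalyticAt.cpow ?_ analyticAt_const ?_)
    · exact analyticAt_id.div analyticAt_const hw
    · simp only [div_self hw, Complex.one_mem_slitPlane]
  · rw [mul_pow, cpow_inv_two_sq, cpow_inv_two_sq, mul_div_cancel₀ _ hw]

theorem analyticAt_evenLift {f : ℂ → ℂ} (hf : Differentiable ℂ f) (heven : ∀ z, f (-z) = f z)
    (w : ℂ) : AnalyticAt ℂ (evenLift f) w := by
  have hdiff : ∀ w₀ : ℂ, w₀ ≠ 0 → DifferentiableAt ℂ (evenLift f) w₀ := by
    intro w₀ hw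
    obtain ⟨r, hr, hr_sq⟩ := exists_analyticAt_sq_eq hw
    have heq : evenLift f = f ∘ r := funext fun w => by
      nth_rw 1 [← hr_sq w]
      exact evenLift_sq heven _
    exact heq ▸ (hf _).comp w₀ hr.differentiableAt
  have hcont : ContinuousAt (evenLift f) w := by
    rcases eq_or_ne w 0 with rfl | hw
    · exact ContinuousAt.comp (f := fun w : ℂ => w ^ (2⁻¹ : ℂ)) hf.continuous.continuousAt
        (Complex.continuousAt_cpow_const_of_re_pos (by simp) (by norm_num))
    · exact (hdiff w hw).continuousAt
  refine Complex.analyticAt_of_differentiable_on_punctured_nhds_of_continuousAt ?_ hcont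
  rcases eq_or_ne w 0 with rfl | hw
  · exact eventually_nhdsWithin_of_forall hdiff
  · exact eventually_nhdsWithin_of_eventually_nhds ((eventually_ne_nhds hw).mono hdiff)

/-- The entire function `sin z / z`, with value `1` at the origin. -/
noncomputable def sinQuot : ℂ → ℂ := dslope Complex.sin 0

theorem mul_sinQuot (z : ℂ) : z * sinQuot z = Complex.sin z := by
  simpa only [sinQuot, sub_zero, smul_eq_mul, Complex.sin_zero] using
    sub_smul_dslope Complex.sin 0 z

theorem sinQuot_zero : sinQuot 0 = 1 := by
  rw [sinQuot, dslope_same, Complex.deriv_sin, Complex.cos_zero]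

theorem sinQuot_neg (z : ℂ) : sinQuot (-z) = sinQuot z := by
  rcases eq_or_ne z 0 with rfl | hz
  · rw [neg_zero]
  · refine mul_left_cancel₀ hz ?_
    rw [← neg_inj, ← neg_mul, mul_sinQuot, mul_sinQuot, Complex.sin_neg]

theorem differentiable_sinQuot : Differentiable ℂ sinQuot :=
  differentiableOn_univ.1 <| (Complex.differentiableOn_dslope univ_mem).2
    Complex.differentiable_sin.differentiableOn

theorem norm_cos_le_exp_norm (z : ℂ) : ‖Complex.cos z‖ ≤ Real.exp ‖z‖ := by
  have hpos := Complex.norm_exp_le_exp_norm (z * Complex.I)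
  have hneg := Complex.norm_exp_le_exp_norm (-z * Complex.I)
  rw [norm_mul, Complex.norm_I, mul_one] at hpos hneg
  rw [norm_neg] at hneg
  rw [Complex.cos, norm_div, Complex.norm_ofNat, div_le_iff₀ two_pos]
  linarith [norm_add_le (Complex.exp (z * Complex.I)) (Complex.exp (-z * Complex.I))]

theorem norm_sinQuot_le_exp_norm (z : ℂ) : ‖sinQuot z‖ ≤ Real.exp ‖z‖ := by
  rcases eq_or_ne z 0 with rfl | hz
  · simp [sinQuot_zero]
  · have hsin : ‖Complex.sin z - Complex.sin 0‖ ≤ Real.exp ‖z‖ * ‖z - 0‖ := by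
      refine (convex_closedBall (0 : ℂ) ‖z‖).norm_image_sub_le_of_norm_deriv_le
        (fun _ _ => Complex.differentiable_sin.differentiableAt) (fun w hw => ?_)
        (Metric.mem_closedBall_self (norm_nonneg z)) (by simp)
      rw [Complex.deriv_sin]
      exact (norm_cos_le_exp_norm w).trans (Real.exp_le_exp.2 (by simpa using hw))
    rw [sub_zero, Complex.sin_zero, sub_zero, ← mul_sinQuot, norm_mul, mul_comm] at hsin
    exact le_of_mul_le_mul_right hsin (norm_pos_iff.2 hz)

end EvenLift

section PuncturedDisc

open Metric

theorem exists_hasDerivAt_logDeriv_of_ne_zero {φ : ℂ → ℂ} {c : ℂ} {R : ℝ} (hR : 0 < R)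
    (hφ : DifferentiableOn ℂ φ (ball c R)) (h0 : ∀ w ∈ ball c R, φ w ≠ 0) :
    ∃ ψ : ℂ → ℂ, ψ c = 0 ∧
      ∀ w ∈ ball c R, HasDerivAt ψ (logDeriv φ w) w ∧ φ w = φ c * Complex.exp (ψ w) := by
  obtain ⟨ψ, hψc, hψ⟩ :=
    ((hφ.deriv isOpen_ball).div hφ h0).isExactOn_ball.with_val_at c 0
  refine ⟨ψ, hψc, fun w hw => ⟨hψ w hw, ?_⟩⟩
  have hder : ∀ u ∈ ball c R, HasDerivAt (fun u => φ u * Complex.exp (-ψ u)) 0 u := by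
    intro u hu
    have hφu := (hφ.differentiableAt (isOpen_ball.mem_nhds hu)).hasDerivAt
    refine (hφu.mul (hψ u hu).neg.cexp).congr_deriv ?_
    rw [Pi.div_apply, mul_neg, mul_neg, mul_left_comm, mul_div_cancel₀ _ (h0 u hu), mul_comm,
      add_neg_cancel]
  have hconst : φ w * Complex.exp (-ψ w) = φ c := by
    simpa [hψc] using isOpen_ball.is_const_of_deriv_eq_zero (convex_ball c R).isPreconnected
      (fun u hu => (hder u hu).differentiableAt.differentiableWithinAt)
      (fun u hu => (hder u hu).deriv) hw (mem_ball_self hR)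
  rw [← hconst, mul_assoc, ← Complex.exp_add, neg_add_cancel, Complex.exp_zero, mul_one]

theorem norm_logDeriv_le_of_ne_zero {φ : ℂ → ℂ} {M R : ℝ} (hM : 0 < M)
    (hφ : DifferentiableOn ℂ φ (ball 0 R)) (h0 : ∀ w ∈ ball (0 : ℂ) R, φ w ≠ 0)
    (hle : ∀ w ∈ ball (0 : ℂ) R, ‖φ w‖ ≤ Real.exp M) (h1 : 1 ≤ ‖φ 0‖) {w : ℂ} (hw : ‖w‖ < R) :
    ‖logDeriv φ w‖ ≤ 8 * M * R / (R - ‖w‖) ^ 2 := by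
  have hR : 0 < R := (norm_nonneg w).trans_lt hw
  obtain ⟨ψ, hψ0, hψ⟩ := exists_hasDerivAt_logDeriv_of_ne_zero hR hφ h0
  have hψd : DifferentiableOn ℂ ψ (ball 0 R) := fun u hu =>
    (hψ u hu).1.differentiableAt.differentiableWithinAt
  have hre : Set.MapsTo ψ (ball 0 R) {z | z.re ≤ M} := fun u hu => by
    have hu' := hle u hu
    rw [(hψ u hu).2, norm_mul, Complex.norm_exp] at hu'
    exact Real.exp_le_exp.1 ((le_mul_of_one_le_left (Real.exp_pos _).le h1).trans hu')
  set ρ : ℝ := (R - ‖w‖) / 2 with hρ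
  have hρ0 : 0 < ρ := by simp only [hρ]; linarith
  have hnorm : ∀ u ∈ closedBall w ρ, ‖u‖ ≤ R - ρ := fun u hu => by
    rw [mem_closedBall, dist_eq_norm] at hu
    linarith [norm_le_norm_add_norm_sub' u w]
  have hsub : closedBall w ρ ⊆ ball (0 : ℂ) R := fun u hu => by
    rw [mem_ball_zero_iff]
    linarith [hnorm u hu]
  have hbound : ∀ u ∈ sphere w ρ, ‖ψ u‖ ≤ 2 * M * R / ρ := fun u hu => by
    have hu' := hnorm u (sphere_subset_closedBall hu)
    refine (Complex.borelCaratheodory_zero hM hψd hre hR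
      (hsub (sphere_subset_closedBall hu)) hψ0).trans ?_
    gcongr <;> linarith
  calc ‖logDeriv φ w‖ = ‖deriv ψ w‖ := by
        rw [(hψ w (hsub (mem_closedBall_self hρ0.le))).1.deriv]
    _ ≤ 2 * M * R / ρ / ρ := Complex.norm_deriv_le_of_forall_mem_sphere_norm_le hρ0
        ((hψd.mono hsub).diffContOnCl_ball subset_rfl) hbound
    _ = 8 * M * R / (R - ‖w‖) ^ 2 := by rw [hρ]; field_simp; ring

theorem exists_abs_le_pi_mul_exp_eq {s₀ s : ℂ} (hs₀ : s₀ ≠ 0) (hs : ‖s‖ = ‖s₀‖) :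
    ∃ θ : ℝ, |θ| ≤ Real.pi ∧ s₀ * Complex.exp (θ * Complex.I) = s := by
  refine ⟨(s / s₀).arg, Complex.abs_arg_le_pi _, ?_⟩
  have := Complex.norm_mul_exp_arg_mul_I (s / s₀)
  rw [norm_div, hs, div_self (norm_ne_zero_iff.2 hs₀), Complex.ofReal_one, one_mul] at this
  rw [this, mul_div_cancel₀ _ hs₀]

theorem norm_mul_exp_lt {s₀ w : ℂ} {r : ℝ} (hs₀ : s₀ ≠ 0) (hw : ‖w‖ < r) :
    ‖s₀ * Complex.exp w‖ < ‖s₀‖ * Real.exp r := by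
  rw [norm_mul, Complex.norm_exp]
  have := norm_pos_iff.2 hs₀
  gcongr
  exact (Complex.re_le_norm w).trans_lt hw

theorem le_norm_mul_exp {s₀ w : ℂ} {r : ℝ} (hw : ‖w‖ ≤ r) :
    ‖s₀‖ * Real.exp (-r) ≤ ‖s₀ * Complex.exp w‖ := by
  rw [norm_mul, Complex.norm_exp]
  gcongr
  exact (abs_le.1 ((Complex.abs_re_le_norm w).trans hw)).1

/- The substitution `ω = a + s₀ exp w` turns the punctured disc into a half-plane, and the disc of
radius `2π` about `0` in the `w`-plane covers the whole circle through `s₀` with room to spare. -/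
theorem norm_sq_mul_logDeriv_le {H : ℂ → ℂ} {a s₀ : ℂ} {C : ℝ} (hC : 0 < C) (hs₀ : s₀ ≠ 0)
    (hH : ∀ s : ℂ, s ≠ 0 → ‖s‖ < ‖s₀‖ * Real.exp (2 * Real.pi) →
      DifferentiableAt ℂ H (a + s) ∧ H (a + s) ≠ 0 ∧ ‖H (a + s)‖ ≤ Real.exp (C / ‖s‖))
    (h1 : 1 ≤ ‖H (a + s₀)‖) {s : ℂ} (hs : ‖s‖ = ‖s₀‖) :
    ‖s ^ 2 * logDeriv H (a + s)‖ ≤ 16 * C * Real.exp (2 * Real.pi) / Real.pi := by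
  have : 0 < ‖s₀‖ := norm_pos_iff.2 hs₀
  have hpi := Real.pi_pos
  have hball : ∀ w ∈ ball (0 : ℂ) (2 * Real.pi), DifferentiableAt ℂ H (a + s₀ * Complex.exp w) ∧
      H (a + s₀ * Complex.exp w) ≠ 0 ∧
      ‖H (a + s₀ * Complex.exp w)‖ ≤ Real.exp (C / ‖s₀ * Complex.exp w‖) := fun w hw =>
    hH _ (mul_ne_zero hs₀ (Complex.exp_ne_zero w)) (norm_mul_exp_lt hs₀ (mem_ball_zero_iff.1 hw))
  have hφ : ∀ w ∈ ball (0 : ℂ) (2 * Real.pi), HasDerivAt (fun w => H (a + s₀ * Complex.exp w))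
      (deriv H (a + s₀ * Complex.exp w) * (s₀ * Complex.exp w)) w := fun w hw =>
    HasDerivAt.comp (h := fun w => a + s₀ * Complex.exp w) w
      (hball w hw).1.hasDerivAt
      (((Complex.hasDerivAt_exp w).const_mul s₀).const_add a)
  obtain ⟨θ, hθ, rfl⟩ := exists_abs_le_pi_mul_exp_eq hs₀ hs
  have hθ' : ‖(θ * Complex.I : ℂ)‖ ≤ Real.pi := by simpa using hθ
  have hlog := norm_logDeriv_le_of_ne_zero (φ := fun w => H (a + s₀ * Complex.exp w))
    (M := C * Real.exp (2 * Real.pi) / ‖s₀‖) (by positivity)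
    (fun w hw => (hφ w hw).differentiableAt.differentiableWithinAt)
    (fun w hw => (hball w hw).2.1)
    (fun w hw => (hball w hw).2.2.trans <| Real.exp_le_exp.2 <|
      calc C / ‖s₀ * Complex.exp w‖ ≤ C / (‖s₀‖ * Real.exp (-(2 * Real.pi))) := by
            gcongr
            exact le_norm_mul_exp (mem_ball_zero_iff.1 hw).le
        _ = C * Real.exp (2 * Real.pi) / ‖s₀‖ := by rw [Real.exp_neg]; field_simp)
    (by simpa using h1) (w := θ * Complex.I) (by linarith)
  rw [logDeriv_apply, (hφ _ (by rw [mem_ball_zero_iff]; linarith)).deriv, mul_comm,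
    mul_div_assoc, ← logDeriv_apply, norm_mul, hs] at hlog
  calc _ = ‖s₀‖ * (‖s₀‖ * ‖logDeriv H (a + s₀ * Complex.exp (θ * Complex.I))‖) := by
        rw [norm_mul, norm_pow, hs, sq, mul_assoc]
    _ ≤ ‖s₀‖ * (8 * (C * Real.exp (2 * Real.pi) / ‖s₀‖) * (2 * Real.pi) / Real.pi ^ 2) := by
        gcongr
        refine hlog.trans ?_
        gcongr
        linarith
    _ = 16 * C * Real.exp (2 * Real.pi) / Real.pi := by field_simp; ring

/-- Growth at most `exp (O (1 / |ω - a|))` near an isolated singularity `a`. -/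
def ExpBdd (f : ℂ → ℂ) (a : ℂ) : Prop :=
  ∃ C : ℝ, f =O[𝓝[≠] a] fun ω => Real.exp (C / ‖ω - a‖)

theorem ExpBdd.exists_norm_le_exp {f : ℂ → ℂ} {a : ℂ} (hf : ExpBdd f a) :
    ∃ C > 0, ∀ᶠ ω in 𝓝[≠] a, ‖f ω‖ ≤ Real.exp (C / ‖ω - a‖) := by
  obtain ⟨C, hC⟩ := hf
  obtain ⟨K, hK0, hK⟩ := hC.exists_pos
  refine ⟨K + |C|, by positivity, ?_⟩
  filter_upwards [hK.bound, self_mem_nhdsWithin,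
    mem_nhdsWithin_of_mem_nhds (ball_mem_nhds a one_pos)] with ω hω hne hball
  have hpos : 0 < ‖ω - a‖ := norm_pos_iff.2 (sub_ne_zero.2 hne)
  have hlt : ‖ω - a‖ < 1 := by rwa [← dist_eq_norm]
  calc ‖f ω‖ ≤ K * Real.exp (C / ‖ω - a‖) := by simpa using hω
    _ ≤ Real.exp (K / ‖ω - a‖) * Real.exp (|C| / ‖ω - a‖) := by
        gcongr
        · refine (le_div_self hK0.le hpos hlt.le).trans ?_
          linarith [Real.add_one_le_exp (K / ‖ω - a‖)]
        · exact le_abs_self C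
    _ = Real.exp ((K + |C|) / ‖ω - a‖) := by rw [← Real.exp_add, add_div]

theorem ExpBdd.isBigO_logDeriv {H : ℂ → ℂ} {a : ℂ} (hub : ExpBdd H a)
    (hd : ∀ᶠ ω in 𝓝[≠] a, DifferentiableAt ℂ H ω) (hne : ∀ᶠ ω in 𝓝[≠] a, H ω ≠ 0)
    (h1 : ∀ᶠ r : ℝ in 𝓝[>] 0, ∃ s : ℂ, ‖s‖ = r ∧ 1 ≤ ‖H (a + s)‖) :
    (fun ω => (ω - a) ^ 2 * logDeriv H ω) =O[𝓝[≠] a] fun _ => (1 : ℂ) := by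
  obtain ⟨C, hC0, hC⟩ := hub.exists_norm_le_exp
  have hall := hd.and (hne.and hC)
  rw [eventually_nhdsWithin_iff, Metric.eventually_nhds_iff] at hall h1
  obtain ⟨r, hr, hall⟩ := hall
  obtain ⟨r', hr', h1⟩ := h1
  refine IsBigO.of_bound (16 * C * Real.exp (2 * Real.pi) / Real.pi) ?_
  rw [eventually_nhdsWithin_iff, Metric.eventually_nhds_iff]
  refine ⟨min (r * Real.exp (-(2 * Real.pi))) r', by positivity, fun ω hω hωa => ?_⟩
  have hpos : 0 < ‖ω - a‖ := norm_pos_iff.2 (sub_ne_zero.2 hωa)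
  rw [dist_eq_norm, lt_min_iff] at hω
  obtain ⟨s₀, hs₀, hHs₀⟩ := h1 (by simpa using hω.2) hpos
  have hs₀0 : s₀ ≠ 0 := norm_pos_iff.1 (hs₀ ▸ hpos)
  have key := norm_sq_mul_logDeriv_le hC0 hs₀0 (fun s hs hlt => ?_) hHs₀ hs₀.symm
  · simpa using key
  · have hlt' : ‖s‖ < r := calc
      ‖s‖ < ‖ω - a‖ * Real.exp (2 * Real.pi) := by rwa [← hs₀]
      _ < r * Real.exp (-(2 * Real.pi)) * Real.exp (2 * Real.pi) := by gcongr; exact hω.1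
      _ = r := by rw [mul_assoc, ← Real.exp_add, neg_add_cancel, Real.exp_zero, mul_one]
    simpa using hall (y := a + s) (by simpa using hlt') (by simpa using hs)

theorem exists_analyticAt_eventuallyEq_of_isBigO_one {f : ℂ → ℂ} {a : ℂ}
    (hd : ∀ᶠ ω in 𝓝[≠] a, DifferentiableAt ℂ f ω)
    (hf : f =O[𝓝[≠] a] fun _ => (1 : ℂ)) :
    ∃ Q : ℂ → ℂ, AnalyticAt ℂ Q a ∧ Q =ᶠ[𝓝[≠] a] f := by
  classical
  have hbdd : IsBoundedUnder (· ≤ ·) (𝓝[≠] a) fun ω => ‖f ω - f a‖ :=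
    (isBigO_one_iff ℂ).1 (hf.sub (isBigO_const_const (f a) one_ne_zero _))
  have hlim := Complex.tendsto_limUnder_of_differentiable_on_punctured_nhds_of_bounded_under hd hbdd
  have heq : Function.update f a (limUnder (𝓝[≠] a) f) =ᶠ[𝓝[≠] a] f :=
    (Function.update_eventuallyEq_nhdsNE ..)
  refine ⟨_, Complex.analyticAt_of_differentiable_on_punctured_nhds_of_continuousAt ?_
    (continuousAt_update_same.2 hlim), heq⟩
  filter_upwards [hd, self_mem_nhdsWithin] with ω hω hne
  exact hω.congr_of_eventuallyEq
    (eventuallyEq_of_mem (isOpen_ne.mem_nhds hne) fun z hz => Function.update_of_ne hz _ _)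

theorem monotoneOn_pow_mul_norm_sq {Φ : ℝ → ℂ} {b : ℝ} {k : ℕ}
    (hΦ : ∀ x ∈ Set.Ioo 0 b, DifferentiableAt ℝ Φ x)
    (hle : ∀ x ∈ Set.Ioo 0 b, x * ‖deriv Φ x‖ ≤ k * ‖Φ x‖) :
    MonotoneOn (fun x => x ^ (2 * k) * ‖Φ x‖ ^ 2) (Set.Ioo 0 b) := by
  have hd : ∀ x ∈ Set.Ioo 0 b, HasDerivAt (fun x => x ^ (2 * k) * ‖Φ x‖ ^ 2)
      ((2 * k : ℕ) * x ^ (2 * k - 1) * ‖Φ x‖ ^ 2 + x ^ (2 * k) * (2 * inner ℝ (Φ x) (deriv Φ x)))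
      x := fun x hx => (hasDerivAt_pow (2 * k) x).mul (hΦ x hx).hasDerivAt.norm_sq
  refine monotoneOn_of_deriv_nonneg (convex_Ioo 0 b)
    (fun x hx => (hd x hx).continuousAt.continuousWithinAt)
    (fun x hx => (hd x (by simpa using hx)).differentiableAt.differentiableWithinAt) fun x hx => ?_
  rw [interior_Ioo] at hx
  rw [(hd x hx).deriv]
  have hx0 : 0 < x := hx.1
  have hinner : -(‖Φ x‖ * ‖deriv Φ x‖) ≤ inner ℝ (Φ x) (deriv Φ x) :=
    (abs_le.1 (abs_real_inner_le_norm _ _)).1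
  have hsum : 0 ≤ 2 * (k * ‖Φ x‖ ^ 2 + x * inner ℝ (Φ x) (deriv Φ x)) := by
    nlinarith [hle x hx, norm_nonneg (Φ x)]
  refine nonneg_of_mul_nonneg_right (a := x) ?_ hx0
  rcases k.eq_zero_or_pos with rfl | hk
  · simpa [mul_left_comm] using hsum
  · calc 0 ≤ x ^ (2 * k) * (2 * (k * ‖Φ x‖ ^ 2 + x * inner ℝ (Φ x) (deriv Φ x))) := by positivity
      _ = _ := by
        obtain ⟨m, hm⟩ : ∃ m, 2 * k = m + 1 := ⟨2 * k - 1, by lia⟩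
        rw [hm, Nat.add_sub_cancel, ← hm]
        push_cast
        rw [hm]
        ring

theorem polyBdd_of_isBigO_deriv {Φ : ℝ → ℂ} (hΦ : ∀ᶠ x in 𝓝[>] 0, DifferentiableAt ℝ Φ x)
    (hO : (fun x => x * ‖deriv Φ x‖) =O[𝓝[>] 0] Φ) :
    PolyBdd (𝓝[>] 0) (fun x : ℝ => (x : ℂ)⁻¹) Φ := by
  obtain ⟨c, hc⟩ := hO.bound
  obtain ⟨k, hk⟩ := exists_nat_ge c
  obtain ⟨b, hb, hball⟩ := mem_nhdsGT_iff_exists_Ioo_subset.1 (hΦ.and hc)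
  have hb : 0 < b := hb
  have hmono := monotoneOn_pow_mul_norm_sq (b := b) (k := k) (fun x hx => (hball hx).1)
    fun x hx => calc
      x * ‖deriv Φ x‖ ≤ c * ‖Φ x‖ := by simpa [abs_of_pos hx.1] using (hball hx).2
      _ ≤ k * ‖Φ x‖ := by gcongr
  set m : ℝ := (b / 2) ^ (2 * k) * ‖Φ (b / 2)‖ ^ 2
  refine ⟨k, IsBigO.of_bound (√m) ?_⟩
  filter_upwards [Ioo_mem_nhdsGT (half_pos hb)] with x hx
  have hx0 : 0 < x := hx.1
  have hle : (x ^ k * ‖Φ x‖) ^ 2 ≤ m := by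
    have := hmono ⟨hx0, by linarith [hx.2]⟩ ⟨half_pos hb, half_lt_self hb⟩ hx.2.le
    rwa [mul_pow, ← pow_mul, mul_comm k 2]
  calc ‖Φ x‖ = x ^ k * ‖Φ x‖ * x⁻¹ ^ k := by
        rw [inv_pow, mul_right_comm, mul_inv_cancel₀ (by positivity), one_mul]
    _ ≤ √m * (1 + x⁻¹) ^ k := by
        gcongr
        · exact Real.le_sqrt_of_sq_le hle
        · linarith
    _ = √m * ‖(1 + ‖((x : ℂ))⁻¹‖) ^ k‖ := by
        rw [norm_inv, Complex.norm_real, Real.norm_of_nonneg hx0.le, Real.norm_of_nonneg]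
        positivity

theorem tendsto_add_ofReal_mul_nhdsNE {v : ℂ} (hv : v ≠ 0) (a : ℂ) :
    Tendsto (fun x : ℝ => a + x * v) (𝓝[>] 0) (𝓝[≠] a) := by
  refine tendsto_nhdsWithin_iff.2
    ⟨(Continuous.tendsto' (by fun_prop) _ _ (by simp)).mono_left nhdsWithin_le_nhds, ?_⟩
  filter_upwards [self_mem_nhdsWithin] with x hx
  simpa [hv] using (ne_of_gt hx : x ≠ 0)

theorem eventually_hasDerivAt_comp_ray {H Q : ℂ → ℂ} {a u : ℂ} (hu : u ≠ 0)
    (hH : ∀ᶠ ω in 𝓝[≠] a, AnalyticAt ℂ H ω) (hne : ∀ᶠ ω in 𝓝[≠] a, H ω ≠ 0)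
    (hQH : Q =ᶠ[𝓝[≠] a] fun ω => (ω - a) ^ 2 * logDeriv H ω) :
    ∀ᶠ x : ℝ in 𝓝[>] 0, HasDerivAt (fun x : ℝ => H (a + x * u))
      (Q (a + x * u) / (x ^ 2 * u) * H (a + x * u)) x := by
  have hlim := tendsto_add_ofReal_mul_nhdsNE hu a
  filter_upwards [hlim.eventually hH, hlim.eventually hne, hlim.eventually hQH,
    self_mem_nhdsWithin] with x hx hx' hQx hx0
  have hx0 : (x : ℂ) ≠ 0 := Complex.ofReal_ne_zero.2 (ne_of_gt hx0)
  have hline : HasDerivAt (fun x : ℝ => a + x * u) u x := by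
    simpa using ((Complex.ofRealCLM.hasDerivAt (x := x)).mul_const u).const_add a
  refine (hx.differentiableAt.hasDerivAt.comp x hline).congr_deriv ?_
  rw [hQx, logDeriv_apply, add_sub_cancel_left]
  field_simp

theorem isBigO_sub_ray {Q : ℂ → ℂ} {a u : ℂ} (hu : u ≠ 0) (hQ : DifferentiableAt ℂ Q a) :
    (fun x : ℝ => Q (a + x * u) - Q a) =O[𝓝[>] 0] fun x : ℝ => x :=
  (hQ.isBigO_sub.comp_tendsto
    ((tendsto_add_ofReal_mul_nhdsNE hu a).mono_right nhdsWithin_le_nhds)).trans <|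
      IsBigO.of_bound ‖u‖ <| .of_forall fun x => by simp [mul_comm]

/- The double poles of `logDeriv H` at the two ends of the segment from `a - x v` to `a + x v`
cancel, so that the logarithmic derivative of the product has only a simple pole. -/
theorem polyBdd_mul_of_logDeriv {H Q : ℂ → ℂ} {a v : ℂ} (hv : v ≠ 0)
    (hH : ∀ᶠ ω in 𝓝[≠] a, AnalyticAt ℂ H ω) (hne : ∀ᶠ ω in 𝓝[≠] a, H ω ≠ 0)
    (hQ : DifferentiableAt ℂ Q a)
    (hQH : Q =ᶠ[𝓝[≠] a] fun ω => (ω - a) ^ 2 * logDeriv H ω) :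
    PolyBdd (𝓝[>] 0) (fun x : ℝ => (x : ℂ)⁻¹) fun x : ℝ => H (a + x * v) * H (a + x * -v) := by
  have hnv := neg_ne_zero.2 hv
  have hpos := eventually_hasDerivAt_comp_ray hv hH hne hQH
  have hneg := eventually_hasDerivAt_comp_ray hnv hH hne hQH
  obtain ⟨c, hc⟩ := ((isBigO_sub_ray hv hQ).sub (isBigO_sub_ray hnv hQ)).bound
  refine polyBdd_of_isBigO_deriv ?_ (IsBigO.of_bound (c / ‖v‖) ?_)
  · filter_upwards [hpos, hneg] with x h₁ h₂ using (h₁.mul h₂).differentiableAt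
  filter_upwards [hpos, hneg, hc, self_mem_nhdsWithin] with x hd₁ hd₂ hcx hx
  have hx : 0 < x := hx
  have hxc : (x : ℂ) ≠ 0 := Complex.ofReal_ne_zero.2 hx.ne'
  have hderiv : deriv (fun x : ℝ => H (a + x * v) * H (a + x * -v)) x =
      (Q (a + x * v) - Q a - (Q (a + x * -v) - Q a)) / (x ^ 2 * v) *
        (H (a + x * v) * H (a + x * -v)) := by
    rw [deriv_fun_mul hd₁.differentiableAt hd₂.differentiableAt, hd₁.deriv, hd₂.deriv]
    field_simp
    ring
  calc ‖x * ‖deriv (fun x : ℝ => H (a + x * v) * H (a + x * -v)) x‖‖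
      = x * (‖Q (a + x * v) - Q a - (Q (a + x * -v) - Q a)‖ / (x ^ 2 * ‖v‖)) *
          ‖H (a + x * v) * H (a + x * -v)‖ := by
        rw [hderiv, norm_mul, norm_norm, Real.norm_of_nonneg hx.le, norm_mul, norm_div, norm_mul,
          norm_pow, Complex.norm_real, Real.norm_of_nonneg hx.le, mul_assoc]
    _ ≤ x * (c * x / (x ^ 2 * ‖v‖)) * ‖H (a + x * v) * H (a + x * -v)‖ := by
        gcongr
        rwa [Real.norm_of_nonneg hx.le] at hcx
    _ = c / ‖v‖ * ‖H (a + x * v) * H (a + x * -v)‖ := by field_simp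

theorem frequently_eq_zero_of_superpolynomialDecay_inv {H : ℂ → ℂ} {a v : ℂ} (hv : v ≠ 0)
    (hH : ∀ᶠ ω in 𝓝[≠] a, AnalyticAt ℂ H ω) (hub : ExpBdd H a)
    (hpos : SuperpolynomialDecay (𝓝[>] 0) (fun x : ℝ => (x : ℂ)⁻¹) fun x => (H (a + x * v))⁻¹)
    (hneg : SuperpolynomialDecay (𝓝[>] 0) (fun x : ℝ => (x : ℂ)⁻¹) fun x => (H (a + x * -v))⁻¹) :
    ∃ᶠ ω in 𝓝[≠] a, H ω = 0 := by
  intro hne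
  have hlarge : ∀ᶠ x : ℝ in 𝓝[>] 0, 1 ≤ ‖H (a + x * v)‖ := by
    filter_upwards [(tendsto_zero_of_superpolynomialDecay hpos).norm.eventually_lt_const
      (by simp : ‖(0 : ℂ)‖ < 1), (tendsto_add_ofReal_mul_nhdsNE hv a).eventually hne] with x hx hx'
    rw [norm_inv, inv_lt_one₀ (norm_pos_iff.2 hx')] at hx
    exact hx.le
  have hcircle : ∀ᶠ r : ℝ in 𝓝[>] 0, ∃ s : ℂ, ‖s‖ = r ∧ 1 ≤ ‖H (a + s)‖ := by
    have hv0 : 0 < ‖v‖ := norm_pos_iff.2 hv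
    filter_upwards [eventually_nhdsGT_zero_mul_left (inv_pos.2 hv0) hlarge,
      self_mem_nhdsWithin] with r hr hr0
    refine ⟨_, ?_, hr⟩
    have hr0 : 0 < r := hr0
    rw [norm_mul, Complex.norm_real, Real.norm_of_nonneg (by positivity)]
    field_simp
  have hlog := hub.isBigO_logDeriv (hH.mono fun _ h => h.differentiableAt) hne hcircle
  obtain ⟨Q, hQ, hQeq⟩ := exists_analyticAt_eventuallyEq_of_isBigO_one
    (by
      filter_upwards [hH, hne] with ω hω hω0
      exact ((differentiableAt_id.sub_const a).pow 2).mul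
        (hω.deriv.differentiableAt.div hω.differentiableAt hω0)) hlog
  have hbdd := polyBdd_mul_of_logDeriv hv hH hne hQ.differentiableAt hQeq
  have hprod := hbdd.mul_superpolynomialDecay
    ((polyBdd_of_superpolynomialDecay hpos).mul_superpolynomialDecay hneg)
  have hone : ∀ᶠ x : ℝ in 𝓝[>] 0, H (a + x * v) * H (a + x * -v) *
      ((H (a + x * v))⁻¹ * (H (a + x * -v))⁻¹) = 1 := by
    filter_upwards [(tendsto_add_ofReal_mul_nhdsNE hv a).eventually hne,
      (tendsto_add_ofReal_mul_nhdsNE (neg_ne_zero.2 hv) a).eventually hne] with x h₁ h₂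
    rw [← mul_inv, mul_inv_cancel₀ (mul_ne_zero h₁ h₂)]
  exact one_ne_zero (tendsto_nhds_unique
    ((tendsto_const_nhds (x := (1 : ℂ))).congr' (hone.mono fun _ h => h.symm))
    (tendsto_zero_of_superpolynomialDecay hprod))

end PuncturedDisc

/-- The coefficient `g` of a medium as a function of its refractive index. -/
noncomputable def Polarization.single : Polarization → ℂ → ℂ
  | .TE, n => n
  | .TM, n => n⁻¹

namespace Polarization

variable (p : Polarization)

theorem coeff_eq_single (n : ℕ → ℂ) (m : ℕ) : p.coeff n m = p.single (n m) := by
  cases p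
  · rfl
  · exact one_div _

theorem single_ne_zero {n : ℂ} (hn : n ≠ 0) : p.single n ≠ 0 := by
  cases p
  · exact hn
  · exact inv_ne_zero hn

theorem single_sq (n : ℂ) : p.single n ^ 2 = p.single (n ^ 2) := by
  cases p
  · rfl
  · exact inv_pow n 2

theorem analyticAt_single {f : ℂ → ℂ} {ω : ℂ} (hf : AnalyticAt ℂ f ω) (h0 : f ω ≠ 0) :
    AnalyticAt ℂ (fun z => p.single (f z)) ω := by
  cases p
  · exact hf
  · exact hf.inv h0

theorem meromorphicAt_single {f : ℂ → ℂ} {ω : ℂ} (hf : MeromorphicAt f ω) :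
    MeromorphicAt (fun z => p.single (f z)) ω := by
  cases p
  · exact hf
  · exact hf.inv

theorem polyInv_single {ι : Type*} {l : Filter ι} {k f : ι → ℂ} (hf : PolyBdd l k f)
    (hf' : PolyInv l k f) : PolyInv l k fun i => p.single (f i) := by
  cases p
  · exact hf'
  · exact .inv hf hf'.ne_zero

theorem polyBdd_single {ι : Type*} {l : Filter ι} {k f : ι → ℂ} (hf : PolyBdd l k f)
    (hf' : PolyInv l k f) : PolyBdd l k fun i => p.single (f i) := by
  cases p
  · exact hf
  · exact hf'.polyBdd_inv

end Polarization

/-- The characteristic matrix of a layer as a function of the square `w` of its refractive index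
and of `κ = d ω / c`, single-valued and analytic in both. -/
noncomputable def charMatrix (p : Polarization) (w κ : ℂ) : Matrix (Fin 2) (Fin 2) ℂ :=
  match p with
  | .TE => !![evenLift Complex.cos (w * κ ^ 2), -Complex.I * (κ * evenLift sinQuot (w * κ ^ 2));
      -Complex.I * (w * κ * evenLift sinQuot (w * κ ^ 2)), evenLift Complex.cos (w * κ ^ 2)]
  | .TM => !![evenLift Complex.cos (w * κ ^ 2), -Complex.I * (w * κ * evenLift sinQuot (w * κ ^ 2));
      -Complex.I * (κ * evenLift sinQuot (w * κ ^ 2)), evenLift Complex.cos (w * κ ^ 2)]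

theorem charMatrix_sq (p : Polarization) {n : ℂ} (hn : n ≠ 0) (κ : ℂ) :
    charMatrix p (n ^ 2) κ = layerMatrix (p.single n) (n * κ) := by
  have hcos : evenLift Complex.cos (n ^ 2 * κ ^ 2) = Complex.cos (n * κ) := by
    rw [← mul_pow, evenLift_sq Complex.cos_neg]
  have hsin : evenLift sinQuot (n ^ 2 * κ ^ 2) = sinQuot (n * κ) := by
    rw [← mul_pow, evenLift_sq sinQuot_neg]
  cases p <;>
  · simp only [charMatrix, layerMatrix, hcos, hsin, Polarization.single, ← mul_sinQuot (n * κ)]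
    congr! 4 <;> field_simp

theorem analyticAt_charMatrix (p : Polarization) {w κ : ℂ → ℂ} {ω : ℂ} (hw : AnalyticAt ℂ w ω)
    (hκ : AnalyticAt ℂ κ ω) (a b : Fin 2) :
    AnalyticAt ℂ (fun z => charMatrix p (w z) (κ z) a b) ω := by
  have harg : AnalyticAt ℂ (fun z => w z * κ z ^ 2) ω := hw.mul (hκ.pow 2)
  have hcos : AnalyticAt ℂ (fun z => evenLift Complex.cos (w z * κ z ^ 2)) ω :=
    (analyticAt_evenLift Complex.differentiable_cos Complex.cos_neg _).comp_of_eq harg rfl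
  have hsin : AnalyticAt ℂ (fun z => evenLift sinQuot (w z * κ z ^ 2)) ω :=
    (analyticAt_evenLift differentiable_sinQuot sinQuot_neg _).comp_of_eq harg rfl
  have hκsin := analyticAt_const (v := -Complex.I) |>.mul (hκ.mul hsin)
  have hwκsin := analyticAt_const (v := -Complex.I) |>.mul ((hw.mul hκ).mul hsin)
  cases p <;> fin_cases a <;> fin_cases b <;> first | exact hcos | exact hκsin | exact hwκsin

namespace LorentzStack

open Polynomial

variable (S : LorentzStack) (p : Polarization)

/-- `ω_j² - ω² - i Γ_j ω` as a polynomial in `ω`. -/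
noncomputable def lorentzPoly (j : ℕ) : ℂ[X] :=
  C ((S.charFreq j : ℂ) ^ 2) - X ^ 2 - C (Complex.I * (S.damping j : ℂ)) * X

theorem eval_lorentzPoly (j : ℕ) (ω : ℂ) : (S.lorentzPoly j).eval ω = S.lorentzDenom j ω := by
  simp only [lorentzPoly, lorentzDenom, eval_sub, eval_mul, eval_pow, eval_C, eval_X]

/-- The denominator of the squared refractive index of medium `m`, a polynomial in `ω`; for the
half-spaces it is `1`. -/
noncomputable def den (m : ℕ) : ℂ[X] :=
  if m = 0 ∨ m = S.N + 1 then 1 else S.lorentzPoly m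

/-- The numerator of the squared refractive index of medium `m`, a polynomial in `ω`. -/
noncomputable def num (m : ℕ) : ℂ[X] :=
  if m = 0 then C ((S.nIn : ℂ) ^ 2) else if m = S.N + 1 then C ((S.nOut : ℂ) ^ 2)
  else S.lorentzPoly m + C (S.strength m : ℂ)

/-- The square of the refractive index of medium `m`, a single-valued function of `ω`. -/
noncomputable def indexSq (m : ℕ) (ω : ℂ) : ℂ :=
  (S.num m).eval ω / (S.den m).eval ω

theorem eval_den_layer {m : ℕ} (h₁ : 1 ≤ m) (h₂ : m ≤ S.N) (ω : ℂ) :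
    (S.den m).eval ω = S.lorentzDenom m ω := by
  rw [den, if_neg (by lia), eval_lorentzPoly]

theorem eval_num_layer {m : ℕ} (h₁ : 1 ≤ m) (h₂ : m ≤ S.N) (ω : ℂ) :
    (S.num m).eval ω = S.lorentzDenom m ω + S.strength m := by
  rw [num, if_neg (by lia), if_neg (by lia), eval_add, eval_lorentzPoly, eval_C]

theorem indexSq_zero (ω : ℂ) : S.indexSq 0 ω = (S.nIn : ℂ) ^ 2 := by
  simp [indexSq, num, den]

theorem indexSq_last (ω : ℂ) : S.indexSq (S.N + 1) ω = (S.nOut : ℂ) ^ 2 := by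
  simp [indexSq, num, den]

theorem indexSq_layer {m : ℕ} (h₁ : 1 ≤ m) (h₂ : m ≤ S.N) {ω : ℂ}
    (h : S.lorentzDenom m ω ≠ 0) :
    S.indexSq m ω = 1 + (S.strength m : ℂ) / S.lorentzDenom m ω := by
  rw [indexSq, S.eval_den_layer h₁ h₂, S.eval_num_layer h₁ h₂, add_div, div_self h]

theorem meromorphicAt_indexSq (m : ℕ) (ω : ℂ) : MeromorphicAt (S.indexSq m) ω :=
  (S.num m).differentiable.analyticAt ω |>.meromorphicAt.div
    ((S.den m).differentiable.analyticAt ω).meromorphicAt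

theorem analyticAt_indexSq {m : ℕ} {ω : ℂ} (h : (S.den m).eval ω ≠ 0) :
    AnalyticAt ℂ (S.indexSq m) ω :=
  ((S.num m).differentiable.analyticAt ω).div ((S.den m).differentiable.analyticAt ω) h

theorem layer_of_eval_den_eq_zero {m : ℕ} {a : ℂ} (hm : m ≤ S.N + 1)
    (h : (S.den m).eval a = 0) : 1 ≤ m ∧ m ≤ S.N := by
  by_cases hhalf : m = 0 ∨ m = S.N + 1
  · rw [den, if_pos hhalf, eval_one] at h
    exact absurd h one_ne_zero
  · lia

theorem eval_num_ne_zero_of_eval_den_eq_zero {m : ℕ} {a : ℂ} (hm : m ≤ S.N + 1)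
    (h : (S.den m).eval a = 0) : (S.num m).eval a ≠ 0 := by
  obtain ⟨h₁, h₂⟩ := S.layer_of_eval_den_eq_zero hm h
  rw [S.eval_den_layer h₁ h₂] at h
  rw [S.eval_num_layer h₁ h₂, h, zero_add]
  exact_mod_cast (S.strength_pos m h₁ h₂).ne'

theorem exists_pos_eval_imaginary {m : ℕ} (hm : m ≤ S.N + 1) {y : ℝ} (hy : 0 < y) :
    ∃ r s : ℝ, 0 < r ∧ 0 < s ∧ (S.num m).eval (y * Complex.I) = r ∧
      (S.den m).eval (y * Complex.I) = s ∧ (1 ≤ m → m ≤ S.N → s ≤ r) := by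
  rcases eq_or_ne m 0 with rfl | h₀
  · exact ⟨S.nIn ^ 2, 1, pow_pos S.nIn_pos 2, one_pos, by simp [num], by simp [den], by lia⟩
  rcases eq_or_ne m (S.N + 1) with rfl | hN
  · exact ⟨S.nOut ^ 2, 1, pow_pos S.nOut_pos 2, one_pos, by simp [num], by simp [den], by lia⟩
  have h₁ : 1 ≤ m := by lia
  have h₂ : m ≤ S.N := by lia
  have heval : S.lorentzDenom m (y * Complex.I) =
      ((S.charFreq m ^ 2 + y ^ 2 + S.damping m * y : ℝ) : ℂ) := by
    rw [lorentzDenom]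
    push_cast
    linear_combination (-(y : ℂ) ^ 2 - (S.damping m : ℂ) * y) * Complex.I_sq
  have hω := S.charFreq_pos m h₁ h₂
  have hΓ := S.damping_nonneg m h₁ h₂
  have hf := S.strength_pos m h₁ h₂
  refine ⟨S.charFreq m ^ 2 + y ^ 2 + S.damping m * y + S.strength m,
    S.charFreq m ^ 2 + y ^ 2 + S.damping m * y, by positivity, by positivity, ?_, ?_, ?_⟩
  · rw [S.eval_num_layer h₁ h₂, heval, ← Complex.ofReal_add]
  · rw [S.eval_den_layer h₁ h₂, heval]
  · intros
    linarith

/-- `ω` is neither a zero nor a pole of the squared index of any medium. -/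
def IsRegularAt (ω : ℂ) : Prop :=
  ∀ m, m ≤ S.N + 1 → (S.num m).eval ω ≠ 0 ∧ (S.den m).eval ω ≠ 0

theorem isRegularAt_imaginary {y : ℝ} (hy : 0 < y) : S.IsRegularAt (y * Complex.I) := by
  intro m hm
  obtain ⟨r, s, hr, hs, hnum, hden, -⟩ := S.exists_pos_eval_imaginary hm hy
  rw [hnum, hden]
  exact ⟨Complex.ofReal_ne_zero.2 hr.ne', Complex.ofReal_ne_zero.2 hs.ne'⟩

theorem num_ne_zero {m : ℕ} (hm : m ≤ S.N + 1) : S.num m ≠ 0 := fun h =>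
  (S.isRegularAt_imaginary one_pos m hm).1 (by rw [h, eval_zero])

theorem den_ne_zero {m : ℕ} (hm : m ≤ S.N + 1) : S.den m ≠ 0 := fun h =>
  (S.isRegularAt_imaginary one_pos m hm).2 (by rw [h, eval_zero])

theorem finite_setOf_not_isRegularAt : {ω | ¬ S.IsRegularAt ω}.Finite := by
  have hfin : (⋃ m ∈ Set.Iic (S.N + 1), {ω | (S.num m * S.den m).IsRoot ω}).Finite :=
    (Set.finite_Iic _).biUnion fun m hm =>
      finite_setOfPred_isRoot (mul_ne_zero (S.num_ne_zero hm) (S.den_ne_zero hm))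
  refine hfin.subset fun ω hω => ?_
  simp only [Set.mem_ofPred_eq, IsRegularAt, not_forall] at hω
  obtain ⟨m, hm, h⟩ := hω
  refine Set.mem_biUnion hm ?_
  rw [Set.mem_ofPred_eq, IsRoot.def, eval_mul, mul_eq_zero]
  tauto

theorem isOpen_setOf_isRegularAt : IsOpen {ω | S.IsRegularAt ω} := by
  simpa only [Set.compl_ofPred, not_not] using
    S.finite_setOf_not_isRegularAt.isClosed.isOpen_compl

theorem eventually_isRegularAt (a : ℂ) : ∀ᶠ ω in 𝓝[≠] a, S.IsRegularAt ω := by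
  filter_upwards [S.finite_setOf_not_isRegularAt.eventually_cofinite_notMem.filter_mono
    (nhdsNE_le_cofinite a)] with ω hω
  exact not_not.1 hω

variable {S} in
theorem IsRegularAt.indexSq_ne_zero {ω : ℂ} (h : S.IsRegularAt ω) {m : ℕ} (hm : m ≤ S.N + 1) :
    S.indexSq m ω ≠ 0 :=
  div_ne_zero (h m hm).1 (h m hm).2

variable {S} in
theorem IsRegularAt.analyticAt_single_indexSq {ω : ℂ} (h : S.IsRegularAt ω) {m : ℕ}
    (hm : m ≤ S.N + 1) : AnalyticAt ℂ (fun z => p.single (S.indexSq m z)) ω :=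
  p.analyticAt_single (S.analyticAt_indexSq (h m hm).2) (h.indexSq_ne_zero hm)

/-- The characteristic matrix of layer `m` at frequency `ω`. -/
noncomputable def layerChar (ω : ℂ) (m : ℕ) : Matrix (Fin 2) (Fin 2) ℂ :=
  charMatrix p (S.indexSq m ω) (S.thickness m * ω / S.c)

theorem analyticAt_layerChar {m : ℕ} {ω : ℂ} (h : (S.den m).eval ω ≠ 0) (a b : Fin 2) :
    AnalyticAt ℂ (fun z => S.layerChar p z m a b) ω :=
  analyticAt_charMatrix p (S.analyticAt_indexSq h)
    ((analyticAt_const.mul analyticAt_id).div analyticAt_const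
      (Complex.ofReal_ne_zero.2 S.c_pos.ne')) a b

theorem layerChar_eq_layerMatrix {m : ℕ} {ω n : ℂ} (hn : n ≠ 0) (hsq : n ^ 2 = S.indexSq m ω) :
    S.layerChar p ω m = layerMatrix (p.single n) (n * (S.thickness m * ω / S.c)) := by
  rw [layerChar, ← hsq, charMatrix_sq p hn]

/-- The field behind the last layer which is excited by an outgoing wave in medium `0`. -/
noncomputable def outField (ω : ℂ) : Fin 2 → ℂ :=
  stackMatrix (S.layerChar p ω) 0 S.N *ᵥ ![1, p.single S.nIn]

/-- The denominator, freed from the factors which depend on the choice of the roots `n_j`. -/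
noncomputable def reducedDenom (ω : ℂ) : ℂ :=
  p.single S.nOut * S.outField p ω 0 + S.outField p ω 1

theorem analyticAt_reducedDenom {ω : ℂ} (h : ∀ m, 1 ≤ m → m ≤ S.N → (S.den m).eval ω ≠ 0) :
    AnalyticAt ℂ (S.reducedDenom p) ω := by
  have hstack : ∀ a b, AnalyticAt ℂ (fun z => stackMatrix (S.layerChar p z) 0 S.N a b) ω :=
    analyticAt_stackMatrix fun m h₁ h₂ => S.analyticAt_layerChar p (h m h₁ (by lia))
  have hfield : ∀ a, AnalyticAt ℂ (fun z => S.outField p z a) ω := fun a => by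
    simpa [outField, Matrix.mulVec, dotProduct, Fin.sum_univ_two] using
      (hstack a 0).fun_add ((hstack a 1).fun_mul analyticAt_const)
  exact (analyticAt_const.mul (hfield 0)).add (hfield 1)

variable {S}

theorem IsIndexAt.sq_eq_indexSq {ω : ℂ} {n : ℕ → ℂ} (hn : S.IsIndexAt ω n)
    (hω : S.IsRegularAt ω) {m : ℕ} (h₁ : 1 ≤ m) (h₂ : m ≤ S.N) : n m ^ 2 = S.indexSq m ω := by
  have hden : S.lorentzDenom m ω ≠ 0 := by
    simpa only [S.eval_den_layer h₁ h₂] using (hω m (by lia)).2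
  rw [S.indexSq_layer h₁ h₂ hden, hn.layer m h₁ h₂ hden]

theorem IsIndexAt.ne_zero {ω : ℂ} {n : ℕ → ℂ} (hn : S.IsIndexAt ω n) (hω : S.IsRegularAt ω)
    {m : ℕ} (h₁ : 1 ≤ m) (h₂ : m ≤ S.N) : n m ≠ 0 := by
  rw [← pow_ne_zero_iff two_ne_zero, hn.sq_eq_indexSq hω h₁ h₂]
  exact hω.indexSq_ne_zero (by lia)

theorem IsIndexAt.denominator_eq {ω : ℂ} {n : ℕ → ℂ} (hn : S.IsIndexAt ω n)
    (hω : S.IsRegularAt ω) : S.denominator p ω n =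
      2 ^ S.N * (∏ m ∈ Finset.Icc 1 S.N, p.single (n m)) * S.reducedDenom p ω := by
  rw [denominator, wolter_snd_eq _ _ _ fun m h₁ h₂ => by
    rw [p.coeff_eq_single]; exact p.single_ne_zero (hn.ne_zero hω h₁ h₂)]
  simp only [p.coeff_eq_single, hn.left, hn.right]
  rw [stackMatrix_congr (M' := S.layerChar p ω) fun m h₁ h₂ => ?_]
  · rfl
  · rw [S.layerChar_eq_layerMatrix p (hn.ne_zero hω h₁ (by lia))
      (hn.sq_eq_indexSq hω h₁ (by lia)), phase, mul_assoc, mul_div_assoc]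

variable (S) in
/-- The single-valued factor by which the squared denominator differs from the squared reduced
denominator. -/
noncomputable def prefactor (ω : ℂ) : ℂ :=
  4 ^ S.N * ∏ m ∈ Finset.Icc 1 S.N, p.single (S.indexSq m ω)

theorem IsIndexAt.denominator_sq_eq {ω : ℂ} {n : ℕ → ℂ} (hn : S.IsIndexAt ω n)
    (hω : S.IsRegularAt ω) :
    S.denominator p ω n ^ 2 = S.prefactor p ω * S.reducedDenom p ω ^ 2 := by
  have hprod : (∏ m ∈ Finset.Icc 1 S.N, p.single (n m)) ^ 2 =
      ∏ m ∈ Finset.Icc 1 S.N, p.single (S.indexSq m ω) := by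
    rw [← Finset.prod_pow]
    refine Finset.prod_congr rfl fun m hm => ?_
    obtain ⟨h₁, h₂⟩ := Finset.mem_Icc.1 hm
    rw [p.single_sq, hn.sq_eq_indexSq hω h₁ h₂]
  have hpow : (4 : ℂ) ^ S.N = (2 ^ S.N) ^ 2 := by
    rw [← pow_mul, mul_comm, pow_mul]
    norm_num
  rw [hn.denominator_eq p hω, prefactor, ← hprod, hpow]
  ring

variable (S) in
theorem meromorphicAt_prefactor (ω : ℂ) : MeromorphicAt (S.prefactor p) ω :=
  (MeromorphicAt.const _ _).fun_mul
    (MeromorphicAt.fun_prod fun m _ => p.meromorphicAt_single (S.meromorphicAt_indexSq m ω))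

theorem IsRegularAt.prefactor_ne_zero {ω : ℂ} (h : S.IsRegularAt ω) : S.prefactor p ω ≠ 0 := by
  refine mul_ne_zero (pow_ne_zero _ (by norm_num)) (Finset.prod_ne_zero_iff.2 fun m hm => ?_)
  exact p.single_ne_zero (h.indexSq_ne_zero (by rw [Finset.mem_Icc] at hm; lia))

theorem IsRegularAt.analyticAt_prefactor {ω : ℂ} (h : S.IsRegularAt ω) :
    AnalyticAt ℂ (S.prefactor p) ω :=
  analyticAt_const.fun_mul (Finset.analyticAt_fun_prod _ fun _ hm =>
    h.analyticAt_single_indexSq p (by rw [Finset.mem_Icc] at hm; lia))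

theorem IsRegularAt.analyticAt_reducedDenom {ω : ℂ} (h : S.IsRegularAt ω) :
    AnalyticAt ℂ (S.reducedDenom p) ω :=
  S.analyticAt_reducedDenom p fun m _ hm => (h m (by lia)).2

end LorentzStack

open Polynomial in
/-- A path in the frequency plane along which a nonzero polynomial is bounded above and below by
powers of the parameter `k`. -/
structure IsTamePath {ι : Type*} (l : Filter ι) (k γ : ι → ℂ) : Prop where
  tendsto_norm_param : Tendsto (fun i => ‖k i‖) l atTop
  polyBdd_eval : ∀ q : ℂ[X], PolyBdd l k fun i => q.eval (γ i)
  polyInv_eval : ∀ q : ℂ[X], q ≠ 0 → PolyInv l k fun i => q.eval (γ i)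

section Paths

variable {ι : Type*} {l : Filter ι} {k γ : ι → ℂ}

theorem IsTamePath.polyBdd (hγ : IsTamePath l k γ) : PolyBdd l k γ := by
  simpa only [Polynomial.eval_X] using hγ.polyBdd_eval Polynomial.X

theorem isTamePath_imaginary :
    IsTamePath atTop (fun y : ℝ => (y : ℂ)) fun y : ℝ => y * Complex.I where
  tendsto_norm_param := by simpa using tendsto_abs_atTop_atTop
  polyBdd_eval q := by
    induction q using Polynomial.induction_on' with
    | add q r hq hr => simpa only [Polynomial.eval_add] using hq.add hr
    | monomial n c =>
      simpa only [Polynomial.eval_monomial] using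
        (polyBdd_const c).mul ((polyBdd_param.mul (polyBdd_const Complex.I)).pow n)
  polyInv_eval q hq := by
    rcases le_or_gt q.degree 0 with hdeg | hdeg
    · rw [Polynomial.eq_C_of_degree_le_zero hdeg] at hq ⊢
      simp only [Polynomial.eval_C]
      exact polyInv_const (Polynomial.C_ne_zero.1 hq)
    · have hI : Tendsto (fun y : ℝ => ‖(y * Complex.I : ℂ)‖) atTop atTop := by
        simpa using tendsto_abs_atTop_atTop
      exact polyInv_of_le_norm one_pos
        ((q.tendsto_norm_atTop hdeg hI).eventually_ge_atTop 1)

variable {f : ℂ → ℂ} {a v : ℂ}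

theorem polyBdd_of_meromorphicAt (hf : MeromorphicAt f a) :
    PolyBdd (𝓝[≠] a) (fun z => (z - a)⁻¹) f := by
  obtain ⟨n, hn⟩ := hf
  refine ((polyBdd_param.pow n).mul
    (polyBdd_of_tendsto (hn.continuousAt.tendsto.mono_left nhdsWithin_le_nhds))).congr' ?_
  filter_upwards [self_mem_nhdsWithin] with z hz
  rw [smul_eq_mul, ← mul_assoc, ← mul_pow, inv_mul_cancel₀ (sub_ne_zero.2 hz), one_pow, one_mul]

theorem polyBdd_ray_of_meromorphicAt (hf : MeromorphicAt f a) (hv : v ≠ 0) :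
    PolyBdd (𝓝[>] 0) (fun x : ℝ => (x : ℂ)⁻¹) fun x => f (a + x * v) := by
  refine ((polyBdd_of_meromorphicAt hf).comp (tendsto_add_ofReal_mul_nhdsNE hv a)).mono_param ?_
  refine (polyBdd_param.mul (polyBdd_const v⁻¹)).congr' (.of_forall fun x => ?_)
  simp only [add_sub_cancel_left, mul_inv]

theorem polyInv_ray_of_meromorphicAt (hf : MeromorphicAt f a) (hv : v ≠ 0)
    (h0 : ¬ ∀ᶠ z in 𝓝[≠] a, f z = 0) :
    PolyInv (𝓝[>] 0) (fun x : ℝ => (x : ℂ)⁻¹) fun x => f (a + x * v) :=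
  ⟨(tendsto_add_ofReal_mul_nhdsNE hv a).eventually
    (hf.eventually_eq_zero_or_eventually_ne_zero.resolve_left h0),
    polyBdd_ray_of_meromorphicAt hf.inv hv⟩

theorem isTamePath_ray (hv : v ≠ 0) (a : ℂ) :
    IsTamePath (𝓝[>] 0) (fun x : ℝ => (x : ℂ)⁻¹) fun x => a + x * v where
  tendsto_norm_param := by
    simpa [Function.comp_def] using
      tendsto_inv_nhdsGT_zero.comp (tendsto_abs_nhdsNE_zero.mono_left (nhdsGT_le_nhdsNE (0 : ℝ)))
  polyBdd_eval q :=
    polyBdd_ray_of_meromorphicAt (q.differentiable.analyticAt a).meromorphicAt hv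
  polyInv_eval q hq := by
    refine polyInv_ray_of_meromorphicAt (q.differentiable.analyticAt a).meromorphicAt hv
      fun h0 => ?_
    have hfin := (Polynomial.finite_setOfPred_isRoot hq).eventually_cofinite_notMem.filter_mono
      (nhdsNE_le_cofinite a)
    obtain ⟨z, hz, hz'⟩ := (h0.and hfin).exists
    exact hz' hz

end Paths

namespace LorentzStack

variable (S : LorentzStack) (p : Polarization)

/-- The squared indices of the media `j` and `k` are different rational functions. -/
def Distinct (j k : ℕ) : Prop :=
  S.num j * S.den k ≠ S.num k * S.den j

theorem distinct_of_den_eq_zero {j k : ℕ} {b : ℂ} (hj : j ≤ S.N + 1)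
    (h₁ : (S.den j).eval b = 0) (h₂ : (S.den k).eval b ≠ 0) : S.Distinct j k := by
  intro h
  have heval := congrArg (Polynomial.eval b) h
  rw [Polynomial.eval_mul, Polynomial.eval_mul, h₁, mul_zero, mul_eq_zero] at heval
  exact heval.elim (S.eval_num_ne_zero_of_eval_den_eq_zero hj h₁) h₂

theorem distinct_layer_halfSpace {j k : ℕ} (h₁ : 1 ≤ j) (h₂ : j ≤ S.N)
    (hk : k = 0 ∨ k = S.N + 1) : S.Distinct j k := by
  have hdeg : (S.lorentzPoly j).degree = 2 := by
    rw [lorentzPoly]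
    compute_degree!
  obtain ⟨b, hb⟩ := IsAlgClosed.exists_root (S.lorentzPoly j) (by rw [hdeg]; norm_num)
  refine S.distinct_of_den_eq_zero (b := b) (by lia) ?_ ?_
  · rwa [S.eval_den_layer h₁ h₂, ← eval_lorentzPoly]
  · rw [den, if_pos hk, Polynomial.eval_one]
    exact one_ne_zero

/-- The refractive index of medium `m`; in a layer its sign is chosen such that waves which leave
the layer upwards decay, i.e. the imaginary part of the phase is nonnegative. -/
noncomputable def evanescentIndex (m : ℕ) (ω : ℂ) : ℂ :=
  if m = 0 then S.nIn else if m = S.N + 1 then S.nOut else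
    if 0 ≤ (S.indexSq m ω ^ (2⁻¹ : ℂ) * ω).im then S.indexSq m ω ^ (2⁻¹ : ℂ)
    else -S.indexSq m ω ^ (2⁻¹ : ℂ)

/-- The phase of layer `m` for the index `evanescentIndex`. -/
noncomputable def evanescentPhase (m : ℕ) (ω : ℂ) : ℂ :=
  S.evanescentIndex m ω * (S.thickness m * ω / S.c)

/-- The coefficient `g_m` for the index `evanescentIndex`. -/
noncomputable def evanescentCoeff (m : ℕ) (ω : ℂ) : ℂ :=
  p.single (S.evanescentIndex m ω)

theorem evanescentCoeff_zero (ω : ℂ) : S.evanescentCoeff p 0 ω = p.single S.nIn := by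
  rw [evanescentCoeff, evanescentIndex, if_pos rfl]

theorem evanescentCoeff_last (ω : ℂ) : S.evanescentCoeff p (S.N + 1) ω = p.single S.nOut := by
  rw [evanescentCoeff, evanescentIndex, if_neg (Nat.succ_ne_zero _), if_pos rfl]

theorem evanescentIndex_sq (m : ℕ) (ω : ℂ) : S.evanescentIndex m ω ^ 2 = S.indexSq m ω := by
  rw [evanescentIndex]
  split_ifs with h₀ hN
  · rw [h₀, indexSq_zero]
  · rw [hN, indexSq_last]
  · exact cpow_inv_two_sq _
  · rw [neg_sq, cpow_inv_two_sq]

theorem evanescentPhase_sq (m : ℕ) (ω : ℂ) :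
    S.evanescentPhase m ω ^ 2 = S.indexSq m ω * (S.thickness m * ω / S.c) ^ 2 := by
  rw [evanescentPhase, mul_pow, evanescentIndex_sq]

theorem evanescentCoeff_sq (m : ℕ) (ω : ℂ) :
    S.evanescentCoeff p m ω ^ 2 = p.single (S.indexSq m ω) := by
  rw [evanescentCoeff, p.single_sq, evanescentIndex_sq]

theorem im_evanescentIndex_mul_nonneg {m : ℕ} (h₁ : 1 ≤ m) (h₂ : m ≤ S.N) (ω : ℂ) :
    0 ≤ (S.evanescentIndex m ω * ω).im := by
  rw [evanescentIndex, if_neg (by lia), if_neg (by lia)]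
  split_ifs with h
  · exact h
  · rw [neg_mul, Complex.neg_im]
    linarith

theorem im_evanescentPhase (m : ℕ) (ω : ℂ) :
    (S.evanescentPhase m ω).im = S.thickness m / S.c * (S.evanescentIndex m ω * ω).im := by
  rw [evanescentPhase, ← Complex.im_ofReal_mul]
  push_cast
  ring_nf

theorem im_evanescentPhase_nonneg {m : ℕ} (h₁ : 1 ≤ m) (h₂ : m ≤ S.N) (ω : ℂ) :
    0 ≤ (S.evanescentPhase m ω).im := by
  rw [im_evanescentPhase]
  exact mul_nonneg (div_pos (S.thickness_pos m h₁ h₂) S.c_pos).le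
    (S.im_evanescentIndex_mul_nonneg h₁ h₂ ω)

variable {S} in
theorem IsRegularAt.evanescentIndex_ne_zero {ω : ℂ} (h : S.IsRegularAt ω) {m : ℕ}
    (hm : m ≤ S.N + 1) : S.evanescentIndex m ω ≠ 0 := by
  rw [← pow_ne_zero_iff two_ne_zero, evanescentIndex_sq]
  exact h.indexSq_ne_zero hm

theorem layerChar_eq_layerMatrix_evanescent {m : ℕ} {ω : ℂ} (h : S.IsRegularAt ω)
    (hm : m ≤ S.N + 1) :
    S.layerChar p ω m = layerMatrix (S.evanescentCoeff p m ω) (S.evanescentPhase m ω) :=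
  S.layerChar_eq_layerMatrix p (h.evanescentIndex_ne_zero hm) (S.evanescentIndex_sq m ω)

section TamePath

variable {ι : Type*} {l : Filter ι} {k γ : ι → ℂ} (hγ : IsTamePath l k γ) {m j j' : ℕ}

include hγ

theorem polyInv_indexSq (hm : m ≤ S.N + 1) : PolyInv l k fun i => S.indexSq m (γ i) :=
  (hγ.polyInv_eval _ (S.num_ne_zero hm)).mul
    (.inv (hγ.polyBdd_eval _) (hγ.polyInv_eval _ (S.den_ne_zero hm)).ne_zero)

theorem polyBdd_indexSq (hm : m ≤ S.N + 1) : PolyBdd l k fun i => S.indexSq m (γ i) :=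
  (hγ.polyBdd_eval _).mul (hγ.polyInv_eval _ (S.den_ne_zero hm)).polyBdd_inv

theorem eventually_isRegularAt_path : ∀ᶠ i in l, S.IsRegularAt (γ i) := by
  have h : ∀ᶠ i in l, ∀ m ∈ Set.Iic (S.N + 1),
      (S.num m).eval (γ i) ≠ 0 ∧ (S.den m).eval (γ i) ≠ 0 :=
    (eventually_all_finite (Set.finite_Iic _)).2 fun m hm =>
      (hγ.polyInv_eval _ (S.num_ne_zero hm)).ne_zero.and
        (hγ.polyInv_eval _ (S.den_ne_zero hm)).ne_zero
  exact h

theorem polyBdd_evanescentIndex (hm : m ≤ S.N + 1) :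
    PolyBdd l k fun i => S.evanescentIndex m (γ i) :=
  .of_sq (by simpa only [evanescentIndex_sq] using S.polyBdd_indexSq hγ hm)

theorem polyInv_evanescentIndex (hm : m ≤ S.N + 1) :
    PolyInv l k fun i => S.evanescentIndex m (γ i) where
  ne_zero := (S.eventually_isRegularAt_path hγ).mono fun _ h => h.evanescentIndex_ne_zero hm
  polyBdd_inv := .of_sq (by
    simpa only [inv_pow, evanescentIndex_sq] using (S.polyInv_indexSq hγ hm).polyBdd_inv)

theorem polyBdd_evanescentCoeff (hm : m ≤ S.N + 1) :
    PolyBdd l k fun i => S.evanescentCoeff p m (γ i) :=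
  p.polyBdd_single (S.polyBdd_evanescentIndex hγ hm) (S.polyInv_evanescentIndex hγ hm)

theorem polyInv_evanescentCoeff (hm : m ≤ S.N + 1) :
    PolyInv l k fun i => S.evanescentCoeff p m (γ i) :=
  p.polyInv_single (S.polyBdd_evanescentIndex hγ hm) (S.polyInv_evanescentIndex hγ hm)

theorem Distinct.polyInv_one_sub_indexSq (h : S.Distinct j j') (hj : j ≤ S.N + 1)
    (hj' : j' ≤ S.N + 1) :
    PolyInv l k fun i => 1 - S.indexSq j (γ i) * (S.indexSq j' (γ i))⁻¹ := by
  have hdiff := hγ.polyInv_eval _ (sub_ne_zero.2 h.symm)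
  have hprod : ∀ᶠ i in l, (S.den j * S.num j').eval (γ i) ≠ 0 :=
    (hγ.polyInv_eval _ (mul_ne_zero (S.den_ne_zero hj) (S.num_ne_zero hj'))).ne_zero
  refine (hdiff.mul (.inv (hγ.polyBdd_eval _) hprod)).congr' ?_
  filter_upwards [S.eventually_isRegularAt_path hγ] with i hi
  have hden := (hi j hj).2
  have hnum := (hi j' hj').1
  simp only [Polynomial.eval_sub, Polynomial.eval_mul, indexSq]
  field_simp

theorem Distinct.polyInv_one_add (h : S.Distinct j j') (hj : j ≤ S.N + 1) (hj' : j' ≤ S.N + 1)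
    {σ : ℂ} (hσ : σ ^ 2 = 1) : PolyInv l k fun i =>
      1 + σ * S.evanescentCoeff p j (γ i) * (S.evanescentCoeff p j' (γ i))⁻¹ := by
  have hsq : PolyInv l k fun i =>
      1 - p.single (S.indexSq j (γ i)) * (p.single (S.indexSq j' (γ i)))⁻¹ := by
    cases p
    · exact h.polyInv_one_sub_indexSq S hγ hj hj'
    · simp only [Polarization.single, inv_inv, mul_comm (S.indexSq j _)⁻¹]
      exact Distinct.polyInv_one_sub_indexSq S hγ (Ne.symm h) hj' hj
  refine PolyInv.of_mul_left (g := fun i =>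
    1 - σ * S.evanescentCoeff p j (γ i) * (S.evanescentCoeff p j' (γ i))⁻¹)
    (hsq.congr' (.of_forall fun i => ?_))
    ((polyBdd_const 1).sub (((polyBdd_const σ).mul (S.polyBdd_evanescentCoeff p hγ hj)).mul
      (S.polyInv_evanescentCoeff p hγ hj').polyBdd_inv))
  simp only [← evanescentCoeff_sq]
  linear_combination (S.evanescentCoeff p j (γ i) * (S.evanescentCoeff p j' (γ i))⁻¹) ^ 2 * hσ

end TamePath

/-- Layer `m` is traversed by evanescent waves along the path `γ`: the wave number has an imaginary
part which grows with the parameter `k`. -/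
def IsEvanescent {ι : Type*} (l : Filter ι) (k γ : ι → ℂ) (m : ℕ) : Prop :=
  ∃ c > 0, ∀ᶠ i in l, c * ‖k i‖ ≤ (S.evanescentPhase m (γ i)).im ^ 2

section Evanescent

variable {S} {ι : Type*} {l : Filter ι} {k γ : ι → ℂ} (hγ : IsTamePath l k γ) {m j : ℕ}

include hγ

theorem IsEvanescent.superpolynomialDecay_cexp (h : S.IsEvanescent l k γ m) (h₁ : 1 ≤ m)
    (h₂ : m ≤ S.N) :
    SuperpolynomialDecay l k fun i => Complex.exp (Complex.I * S.evanescentPhase m (γ i)) := by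
  obtain ⟨c, hc, hle⟩ := h
  exact _root_.superpolynomialDecay_cexp hc hγ.tendsto_norm_param
    (.of_forall fun i => S.im_evanescentPhase_nonneg h₁ h₂ (γ i)) hle

theorem IsEvanescent.eventually_one_le_im (h : S.IsEvanescent l k γ m) (h₁ : 1 ≤ m)
    (h₂ : m ≤ S.N) : ∀ᶠ i in l, 1 ≤ (S.evanescentPhase m (γ i)).im := by
  obtain ⟨c, hc, hle⟩ := h
  filter_upwards [hle, (hγ.tendsto_norm_param.const_mul_atTop hc).eventually_ge_atTop 1]
    with i hi hi'
  exact (one_le_sq_iff₀ (S.im_evanescentPhase_nonneg h₁ h₂ (γ i))).1 (hi'.trans hi)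

theorem IsEvanescent.polyInv_index_add (h : S.IsEvanescent l k γ m) (h₁ : 1 ≤ m) (h₂ : m ≤ S.N)
    (hj₁ : 1 ≤ j) (hj₂ : j ≤ S.N) :
    PolyInv l k fun i => S.evanescentIndex m (γ i) + S.evanescentIndex j (γ i) := by
  have hr : 0 < S.thickness m / S.c := div_pos (S.thickness_pos m h₁ h₂) S.c_pos
  refine PolyInv.of_mul_left (polyInv_of_le_norm (inv_pos.2 hr) ?_) hγ.polyBdd
  filter_upwards [h.eventually_one_le_im hγ h₁ h₂] with i hi
  rw [im_evanescentPhase] at hi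
  calc (S.thickness m / S.c)⁻¹ ≤ (S.evanescentIndex m (γ i) * γ i).im :=
      (inv_le_iff_one_le_mul₀' hr).2 hi
    _ ≤ (S.evanescentIndex m (γ i) * γ i).im + (S.evanescentIndex j (γ i) * γ i).im :=
      le_add_of_nonneg_right (S.im_evanescentIndex_mul_nonneg hj₁ hj₂ _)
    _ = ((S.evanescentIndex m (γ i) + S.evanescentIndex j (γ i)) * γ i).im := by
      rw [add_mul, Complex.add_im]
    _ ≤ _ := (le_abs_self _).trans (Complex.abs_im_le_norm _)

theorem IsEvanescent.polyInv_one_add (h : S.IsEvanescent l k γ m) (h₁ : 1 ≤ m) (h₂ : m ≤ S.N)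
    (hj₁ : 1 ≤ j) (hj₂ : j ≤ S.N) : PolyInv l k fun i =>
      1 + S.evanescentCoeff p m (γ i) * (S.evanescentCoeff p j (γ i))⁻¹ := by
  have hsum := h.polyInv_index_add hγ h₁ h₂ hj₁ hj₂
  have hm : m ≤ S.N + 1 := by lia
  have hj : j ≤ S.N + 1 := by lia
  have hinv {r : ℕ} (hr : r ≤ S.N + 1) : PolyInv l k fun i => (S.evanescentIndex r (γ i))⁻¹ :=
    .inv (S.polyBdd_evanescentIndex hγ hr) (S.polyInv_evanescentIndex hγ hr).ne_zero
  cases p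
  · refine (hsum.mul (hinv hj)).congr' ?_
    filter_upwards [S.eventually_isRegularAt_path hγ] with i hi
    have hn := hi.evanescentIndex_ne_zero hj
    simp only [evanescentCoeff, Polarization.single]
    field_simp
    ring
  · refine (hsum.mul (hinv hm)).congr' ?_
    filter_upwards [S.eventually_isRegularAt_path hγ] with i hi
    have hn := hi.evanescentIndex_ne_zero hm
    simp only [evanescentCoeff, Polarization.single]
    field_simp

end Evanescent

end LorentzStack

/-- The amplitude with which the field `M (1, g)` excites a medium with coefficient `h`. -/
noncomputable def interfaceFactor (M : Matrix (Fin 2) (Fin 2) ℂ) (g h : ℂ) : ℂ :=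
  (M *ᵥ ![1, g]) 0 + (M *ᵥ ![1, g]) 1 * h⁻¹

/-- The product of the interface factors of `M` for all signs of `g` and `h`, as a function of
`G = g²` and `L = (h²)⁻¹`. -/
def signProd (G L : ℂ) (M : Matrix (Fin 2) (Fin 2) ℂ) : ℂ :=
  (M 0 0 ^ 2 + L * M 1 0 ^ 2 - G * M 0 1 ^ 2 - G * L * M 1 1 ^ 2) ^ 2 -
    4 * L * (M 0 0 * M 1 0 - G * M 0 1 * M 1 1) ^ 2

theorem signProd_sq (g h : ℂ) (M : Matrix (Fin 2) (Fin 2) ℂ) :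
    signProd (g ^ 2) (h ^ 2)⁻¹ M = interfaceFactor M g h *
      (interfaceFactor M (-g) h * (interfaceFactor M g (-h) * interfaceFactor M (-g) (-h))) := by
  simp only [signProd, interfaceFactor, Matrix.mulVec, dotProduct, Fin.sum_univ_two,
    Matrix.cons_val_zero, Matrix.cons_val_one, inv_neg, ← inv_pow]
  ring

theorem interfaceFactor_one (g h : ℂ) : interfaceFactor 1 g h = 1 + g * h⁻¹ := by
  simp [interfaceFactor]

theorem analyticAt_signProd {G L : ℂ → ℂ} {M : ℂ → Matrix (Fin 2) (Fin 2) ℂ} {x : ℂ}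
    (hG : AnalyticAt ℂ G x) (hL : AnalyticAt ℂ L x)
    (hM : ∀ a b, AnalyticAt ℂ (fun z => M z a b) x) :
    AnalyticAt ℂ (fun z => signProd (G z) (L z) (M z)) x := by
  unfold signProd
  fun_prop (disch := exact hM _ _)

theorem meromorphicAt_signProd {G L : ℂ → ℂ} {M : ℂ → Matrix (Fin 2) (Fin 2) ℂ} {x : ℂ}
    (hG : MeromorphicAt G x) (hL : MeromorphicAt L x)
    (hM : ∀ a b, MeromorphicAt (fun z => M z a b) x) :
    MeromorphicAt (fun z => signProd (G z) (L z) (M z)) x := by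
  unfold signProd
  fun_prop (disch := exact hM _ _)

theorem im_sq_eq (δ : ℂ) : δ.im ^ 2 = (‖δ ^ 2‖ - (δ ^ 2).re) / 2 := by
  rw [norm_pow, Complex.sq_norm, Complex.normSq_apply, pow_two, pow_two, Complex.mul_re]
  ring

section Fields

variable {ι : Type*} {l : Filter ι} {k g h : ι → ℂ} {M : ι → Matrix (Fin 2) (Fin 2) ℂ}

theorem polyBdd_vec_one (hg : PolyBdd l k g) (a : Fin 2) : PolyBdd l k fun i => ![1, g i] a := by
  fin_cases a
  · exact polyBdd_const 1
  · exact hg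

theorem polyBdd_mulVec_vec_one (hM : ∀ a b, PolyBdd l k fun i => M i a b) (hg : PolyBdd l k g)
    (a : Fin 2) : PolyBdd l k fun i => (M i *ᵥ ![1, g i]) a := by
  simpa only [Matrix.mulVec, dotProduct, Fin.sum_univ_two, Matrix.cons_val_zero,
    Matrix.cons_val_one, mul_one] using (hM a 0).add ((hM a 1).mul hg)

theorem polyBdd_interfaceFactor (hM : ∀ a b, PolyBdd l k fun i => M i a b) (hg : PolyBdd l k g)
    (hh : PolyBdd l k fun i => (h i)⁻¹) :
    PolyBdd l k fun i => interfaceFactor (M i) (g i) (h i) :=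
  (polyBdd_mulVec_vec_one hM hg 0).add ((polyBdd_mulVec_vec_one hM hg 1).mul hh)

theorem polyInv_interfaceFactor_of_signProd (hM : ∀ a b, PolyBdd l k fun i => M i a b)
    (hg : PolyBdd l k g) (hh : PolyBdd l k fun i => (h i)⁻¹)
    (hprod : PolyInv l k fun i => signProd (g i ^ 2) (h i ^ 2)⁻¹ (M i)) :
    PolyInv l k fun i => interfaceFactor (M i) (g i) (h i) := by
  have hneg : PolyBdd l k fun i => (-h i)⁻¹ := by simpa only [inv_neg] using hh.neg
  simp only [signProd_sq] at hprod
  exact hprod.of_mul_left ((polyBdd_interfaceFactor hM hg.neg hh).mul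
    ((polyBdd_interfaceFactor hM hg hneg).mul (polyBdd_interfaceFactor hM hg.neg hneg)))

end Fields

namespace LorentzStack

variable (S : LorentzStack) (p : Polarization)

section EvanescentBlock

variable {S} {ι : Type*} {l : Filter ι} {k γ A : ι → ℂ} {e u : ι → Fin 2 → ℂ}
  (hγ : IsTamePath l k γ) {m j q : ℕ} {σ τ : ℂ}

include hγ

theorem IsEvanescent.superpolynomialDecay_inv_layerGain (h : S.IsEvanescent l k γ m) (h₁ : 1 ≤ m)
    (h₂ : m ≤ S.N) (hA : PolyInv l k A)
    (hB : PolyInv l k fun i => e i 0 + e i 1 * (S.evanescentCoeff p m (γ i))⁻¹) :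
    SuperpolynomialDecay l k fun i => (A i *
      layerGain (S.evanescentCoeff p m (γ i)) (S.evanescentPhase m (γ i)) (e i))⁻¹ :=
  _root_.superpolynomialDecay_inv_layerGain hA (h.superpolynomialDecay_cexp hγ h₁ h₂) hB

theorem IsEvanescent.asympSMul_layerChar (h : S.IsEvanescent l k γ m) (h₁ : 1 ≤ m) (h₂ : m ≤ S.N)
    (hv : AsympSMul l k A e u) (he : ∀ a, PolyBdd l k fun i => e i a)
    (hB : PolyInv l k fun i => e i 0 + e i 1 * (S.evanescentCoeff p m (γ i))⁻¹) :
    AsympSMul l k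
      (fun i => A i * layerGain (S.evanescentCoeff p m (γ i)) (S.evanescentPhase m (γ i)) (e i))
      (fun i => ![1, S.evanescentCoeff p m (γ i)]) (fun i => S.layerChar p (γ i) m *ᵥ u i) := by
  have hm : m ≤ S.N + 1 := by lia
  refine (hv.layer he (S.polyBdd_evanescentCoeff p hγ hm) (S.polyInv_evanescentCoeff p hγ hm)
    (h.superpolynomialDecay_cexp hγ h₁ h₂) hB).congr' ?_
  filter_upwards [S.eventually_isRegularAt_path hγ] with i hi
  rw [S.layerChar_eq_layerMatrix_evanescent p hi hm]

theorem exists_asympSMul_stackMatrix (hq : j + q ≤ S.N)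
    (hev : ∀ m, j < m → m ≤ j + q → S.IsEvanescent l k γ m) (hj : S.Distinct j (j + 1))
    (hσ : σ ^ 2 = 1) :
    ∃ A, AsympSMul l k A
      (fun i => ![1, (if q = 0 then σ else 1) * S.evanescentCoeff p (j + q) (γ i)])
      (fun i =>
        stackMatrix (S.layerChar p (γ i)) j q *ᵥ ![1, σ * S.evanescentCoeff p j (γ i)]) := by
  induction q with
  | zero => exact ⟨_, by simpa [stackMatrix] using asympSMul_refl _⟩
  | succ q ih =>
    obtain ⟨A, hA⟩ := ih (by lia) fun m h₁ h₂ => hev m h₁ (by lia)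
    have hB : PolyInv l k fun i => 1 + (if q = 0 then σ else 1) *
        S.evanescentCoeff p (j + q) (γ i) * (S.evanescentCoeff p (j + q + 1) (γ i))⁻¹ := by
      rcases eq_or_ne q 0 with rfl | hq0
      · simpa using hj.polyInv_one_add S p hγ (by lia) (by lia) hσ
      · simpa [hq0] using (hev (j + q) (by lia) (by lia)).polyInv_one_add p hγ (j := j + q + 1)
          (by lia) (by lia) (by lia) (by lia)
    have hstep := (hev (j + q + 1) (by lia) (by lia)).asympSMul_layerChar p hγ (by lia) (by lia) hA
      (polyBdd_vec_one ((polyBdd_const _).mul (S.polyBdd_evanescentCoeff p hγ (by lia)))) hB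
    simp only [stackMatrix, ← Matrix.mulVec_mulVec, if_neg (Nat.succ_ne_zero q), one_mul]
    exact ⟨_, hstep⟩

theorem eventually_interfaceFactor_ne_zero (hq : j + q ≤ S.N)
    (hev : ∀ m, j < m → m ≤ j + q → S.IsEvanescent l k γ m) (hj : S.Distinct j (j + 1))
    (hj' : S.Distinct (j + q) (j + q + 1)) (hσ : σ ^ 2 = 1) (hτ : τ ^ 2 = 1) :
    ∀ᶠ i in l, interfaceFactor (stackMatrix (S.layerChar p (γ i)) j q)
      (σ * S.evanescentCoeff p j (γ i)) (τ * S.evanescentCoeff p (j + q + 1) (γ i)) ≠ 0 := by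
  obtain ⟨A, hA⟩ := exists_asympSMul_stackMatrix p hγ hq hev hj hσ
  have hsign : (τ⁻¹ * if q = 0 then σ else 1) ^ 2 = 1 := by
    rw [mul_pow, inv_pow, hτ]
    split_ifs <;> simp [hσ]
  have hB := hj'.polyInv_one_add S p hγ (by lia) (by lia) hsign
  have hinv := (S.polyInv_evanescentCoeff p hγ (m := j + q + 1) (by lia)).polyBdd_inv
  refine (hA.polyInv_linearCombination (polyBdd_const 1) ((polyBdd_const τ⁻¹).mul hinv)
    (hB.congr' (.of_forall fun i => ?_))).ne_zero.mono fun i hi => ?_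
  · simp only [Matrix.cons_val_zero, Matrix.cons_val_one]
    ring
  · rwa [one_mul, mul_comm (τ⁻¹ * _), ← mul_inv] at hi

end EvanescentBlock

theorem isEvanescent_imaginary {m : ℕ} (h₁ : 1 ≤ m) (h₂ : m ≤ S.N) :
    S.IsEvanescent atTop (fun y : ℝ => (y : ℂ)) (fun y => y * Complex.I) m := by
  have hpos : 0 < S.thickness m / S.c := div_pos (S.thickness_pos m h₁ h₂) S.c_pos
  refine ⟨(S.thickness m / S.c) ^ 2, by positivity, ?_⟩
  filter_upwards [eventually_ge_atTop 1] with y hy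
  obtain ⟨r, s, hr, hs, hnum, hden, hsr⟩ :=
    S.exists_pos_eval_imaginary (by lia : m ≤ S.N + 1) (by linarith : 0 < y)
  have hsq : S.evanescentPhase m (y * Complex.I) ^ 2 =
      ((-(r / s * (S.thickness m / S.c * y) ^ 2) : ℝ) : ℂ) := by
    rw [evanescentPhase_sq, indexSq, hnum, hden]
    push_cast
    linear_combination r / s * (S.thickness m / S.c * y : ℂ) ^ 2 * Complex.I_sq
  have hrs : 1 ≤ r / s := (one_le_div₀ hs).2 (hsr h₁ h₂)
  have hnonneg : 0 ≤ r / s * (S.thickness m / S.c * y) ^ 2 := by positivity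
  rw [im_sq_eq, hsq, Complex.norm_real, Complex.norm_real, Complex.ofReal_re, norm_neg,
    Real.norm_of_nonneg hnonneg, Real.norm_of_nonneg (by linarith)]
  calc (S.thickness m / S.c) ^ 2 * y ≤ (S.thickness m / S.c) ^ 2 * y ^ 2 := by
        gcongr
        exact le_self_pow₀ hy two_ne_zero
    _ = 1 * (S.thickness m / S.c * y) ^ 2 := by ring
    _ ≤ r / s * (S.thickness m / S.c * y) ^ 2 := by gcongr
    _ = _ := by ring

/-- The sign product of the layers `j + 1, …, j + q` between the media `j` and `j + q + 1`, a
single-valued function of `ω`. -/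
noncomputable def blockProd (j q : ℕ) (ω : ℂ) : ℂ :=
  signProd (p.single (S.indexSq j ω)) (p.single (S.indexSq (j + q + 1) ω))⁻¹
    (stackMatrix (S.layerChar p ω) j q)

variable {S} {j q : ℕ}

theorem exists_blockProd_ne_zero (hq : j + q ≤ S.N) (hj : S.Distinct j (j + 1))
    (hj' : S.Distinct (j + q) (j + q + 1)) : ∃ ω, S.IsRegularAt ω ∧ S.blockProd p j q ω ≠ 0 := by
  have h := fun σ τ (hσ : σ ^ 2 = 1) (hτ : τ ^ 2 = 1) =>
    S.eventually_interfaceFactor_ne_zero p isTamePath_imaginary hq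
      (fun m h₁ h₂ => S.isEvanescent_imaginary (by lia) (by lia)) hj hj' hσ hτ
  have hone : (1 : ℂ) ^ 2 = 1 := one_pow 2
  have hneg : (-1 : ℂ) ^ 2 = 1 := neg_one_sq
  obtain ⟨y, h₁, h₂, h₃, h₄, hreg⟩ := ((h 1 1 hone hone).and <| (h (-1) 1 hneg hone).and <|
    (h 1 (-1) hone hneg).and <| (h (-1) (-1) hneg hneg).and <|
    S.eventually_isRegularAt_path isTamePath_imaginary).exists
  refine ⟨_, hreg, ?_⟩
  simp only [one_mul, neg_one_mul] at h₁ h₂ h₃ h₄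
  rw [blockProd, ← evanescentCoeff_sq, ← evanescentCoeff_sq, signProd_sq]
  exact mul_ne_zero h₁ (mul_ne_zero h₂ (mul_ne_zero h₃ h₄))

variable (S) in
theorem meromorphicAt_blockProd {a : ℂ} (h : ∀ m, j < m → m ≤ j + q → (S.den m).eval a ≠ 0) :
    MeromorphicAt (S.blockProd p j q) a :=
  meromorphicAt_signProd (p.meromorphicAt_single (S.meromorphicAt_indexSq j a))
    (p.meromorphicAt_single (S.meromorphicAt_indexSq (j + q + 1) a)).fun_inv fun b c =>
    (analyticAt_stackMatrix (fun m h₁ h₂ => S.analyticAt_layerChar p (h m h₁ h₂)) b c).meromorphicAt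

theorem IsRegularAt.analyticAt_blockProd {ω : ℂ} (h : S.IsRegularAt ω) (hq : j + q ≤ S.N) :
    AnalyticAt ℂ (S.blockProd p j q) ω :=
  analyticAt_signProd (h.analyticAt_single_indexSq p (by lia))
    ((h.analyticAt_single_indexSq p (by lia)).fun_inv
      (p.single_ne_zero (h.indexSq_ne_zero (by lia)))) fun b c =>
    analyticAt_stackMatrix (fun m _ h₂ => S.analyticAt_layerChar p (h m (by lia)).2) b c

variable (S) in
theorem isPreconnected_setOf_isRegularAt : IsPreconnected {ω | S.IsRegularAt ω} := by
  have hrank : 1 < Module.rank ℝ ℂ := by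
    rw [Complex.rank_real_complex]
    norm_num
  simpa only [Set.compl_ofPred, not_not] using
    (S.finite_setOf_not_isRegularAt.countable.isConnected_compl_of_one_lt_rank hrank).isPreconnected

theorem not_eventually_blockProd_eq_zero (hq : j + q ≤ S.N) (hj : S.Distinct j (j + 1))
    (hj' : S.Distinct (j + q) (j + q + 1)) (a : ℂ) :
    ¬ ∀ᶠ ω in 𝓝[≠] a, S.blockProd p j q ω = 0 := by
  intro hzero
  have hana : AnalyticOnNhd ℂ (S.blockProd p j q) {ω | S.IsRegularAt ω} :=
    fun ω hω => IsRegularAt.analyticAt_blockProd p hω hq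
  obtain ⟨ω₀, ⟨hω₀, hreg⟩, hne⟩ := ((eventually_eventually_nhdsWithin.2 hzero).and
    (S.eventually_isRegularAt a)).and self_mem_nhdsWithin |>.exists
  rw [isOpen_compl_singleton.nhdsWithin_eq hne] at hω₀
  obtain ⟨ω, hω, hne_zero⟩ := exists_blockProd_ne_zero p hq hj hj'
  exact hne_zero (hana.eqOn_zero_of_preconnected_of_eventuallyEq_zero
    S.isPreconnected_setOf_isRegularAt hreg hω₀ hω)

end LorentzStack

section Rays

variable {δ g : ℂ → ℂ} {a v : ℂ} {n : ℤ}

theorem eventually_le_im_sq_ray (hδ : ∀ᶠ z in 𝓝[≠] a, δ z ^ 2 = (z - a) ^ n * g z)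
    (hg : ContinuousAt g a) (hn : n < 0) (hv : v ≠ 0) (him : (v ^ n * g a).im ≠ 0) :
    ∃ c > 0, ∀ᶠ x : ℝ in 𝓝[>] 0, c * ‖(x : ℂ)⁻¹‖ ≤ (δ (a + x * v)).im ^ 2 := by
  obtain ⟨K, hK⟩ : ∃ K, v ^ n * g a = K := ⟨_, rfl⟩
  rw [hK] at him
  have hpos : 0 < (‖K‖ - K.re) / 2 := by
    linarith [Complex.abs_re_lt_norm.2 him, le_abs_self K.re]
  have hray := tendsto_add_ofReal_mul_nhdsNE hv a
  have hlim : Tendsto (fun x : ℝ => v ^ n * g (a + x * v)) (𝓝[>] 0) (𝓝 K) :=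
    hK ▸ (hg.tendsto.comp (hray.mono_right nhdsWithin_le_nhds)).const_mul (v ^ n)
  refine ⟨(‖K‖ - K.re) / 2 / 2, by positivity, ?_⟩
  filter_upwards [hray.eventually hδ, Ioo_mem_nhdsGT one_pos,
    ((hlim.norm.sub ((Complex.continuous_re.tendsto K).comp hlim)).div_const 2).eventually_const_lt
      (half_lt_self hpos)] with x hx hx01 hlt
  have hzpow : x⁻¹ ≤ x ^ n := by
    rw [← _root_.zpow_neg_one]
    exact zpow_le_zpow_right_of_le_one₀ hx01.1 hx01.2.le (by lia)
  have hsq : δ (a + x * v) ^ 2 = ((x ^ n : ℝ) : ℂ) * (v ^ n * g (a + x * v)) := by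
    rw [hx, add_sub_cancel_left, mul_zpow, Complex.ofReal_zpow, mul_assoc]
  rw [im_sq_eq, hsq, norm_mul, Complex.re_ofReal_mul, Complex.norm_real, norm_inv,
    Complex.norm_real, Real.norm_of_nonneg hx01.1.le, Real.norm_of_nonneg (zpow_nonneg hx01.1.le n),
    ← mul_sub, mul_div_assoc, mul_comm (x ^ n)]
  have hinv : 0 ≤ x⁻¹ := inv_nonneg.2 hx01.1.le
  exact mul_le_mul hlt.le hzpow hinv ((half_pos hpos).le.trans hlt.le)

theorem countable_setOf_im_cexp_zpow_mul_eq_zero {K : ℂ} (hK : K ≠ 0) (hn : n ≠ 0) :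
    {θ : ℝ | (Complex.exp (θ * Complex.I) ^ n * K).im = 0}.Countable := by
  refine (Set.countable_range fun m : ℤ => (m * Real.pi - K.arg) / n).mono fun θ hθ => ?_
  have hpolar : Complex.exp (θ * Complex.I) ^ n * K =
      ‖K‖ * Complex.exp ((n * θ + K.arg : ℝ) * Complex.I) := by
    nth_rw 1 [← Complex.norm_mul_exp_arg_mul_I K]
    rw [← Complex.exp_int_mul, mul_left_comm, ← Complex.exp_add]
    push_cast
    ring_nf
  rw [Set.mem_ofPred_eq, hpolar, Complex.im_ofReal_mul, Complex.exp_ofReal_mul_I_im, mul_eq_zero,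
    or_iff_right (norm_ne_zero_iff.2 hK), Real.sin_eq_zero_iff] at hθ
  obtain ⟨m, hm⟩ := hθ
  refine ⟨m, ?_⟩
  have hn' : (n : ℝ) ≠ 0 := Int.cast_ne_zero.2 hn
  field_simp
  linarith

theorem exists_forall_im_zpow_mul_ne_zero {ι : Type*} [Countable ι] {K : ι → ℂ} {n : ι → ℤ}
    (hK : ∀ i, K i ≠ 0) (hn : ∀ i, n i ≠ 0) : ∃ v ≠ 0, ∀ i, (v ^ n i * K i).im ≠ 0 := by
  obtain ⟨θ, hθ⟩ := ((Set.countable_iUnion fun i =>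
    countable_setOf_im_cexp_zpow_mul_eq_zero (hK i) (hn i)).dense_compl ℝ).nonempty
  exact ⟨_, Complex.exp_ne_zero _, fun i hi => hθ (Set.mem_iUnion_of_mem i hi)⟩

theorem im_neg_zpow_mul_ne_zero {K : ℂ} (h : (v ^ n * K).im ≠ 0) : ((-v) ^ n * K).im ≠ 0 := by
  rcases Int.even_or_odd n with hn | hn
  · rwa [hn.neg_zpow]
  · rwa [hn.neg_zpow, neg_mul, Complex.neg_im, neg_ne_zero]

end Rays

namespace LorentzStack

variable (S : LorentzStack) (p : Polarization)

theorem ne_zero_of_eval_den_eq_zero {m : ℕ} {a : ℂ} (hm : m ≤ S.N + 1)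
    (ha : (S.den m).eval a = 0) : a ≠ 0 := by
  rintro rfl
  obtain ⟨h₁, h₂⟩ := S.layer_of_eval_den_eq_zero hm ha
  rw [S.eval_den_layer h₁ h₂, lorentzDenom] at ha
  simp [(S.charFreq_pos m h₁ h₂).ne'] at ha

theorem meromorphicAt_evanescentPhase_sq (m : ℕ) (a : ℂ) :
    MeromorphicAt (fun ω => S.evanescentPhase m ω ^ 2) a := by
  simp only [evanescentPhase_sq]
  have hanal : AnalyticAt ℂ (fun ω : ℂ => (S.thickness m * ω / S.c) ^ 2) a := by fun_prop
  exact (S.meromorphicAt_indexSq m a).mul hanal.meromorphicAt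

theorem meromorphicOrderAt_evanescentPhase_sq_neg {m : ℕ} {a : ℂ} (hm : m ≤ S.N + 1)
    (ha : (S.den m).eval a = 0) :
    meromorphicOrderAt (fun ω => S.evanescentPhase m ω ^ 2) a < 0 := by
  obtain ⟨h₁, h₂⟩ := S.layer_of_eval_den_eq_zero hm ha
  have hd : (S.thickness m : ℂ) ≠ 0 := Complex.ofReal_ne_zero.2 (S.thickness_pos m h₁ h₂).ne'
  have hc : (S.c : ℂ) ≠ 0 := Complex.ofReal_ne_zero.2 S.c_pos.ne'
  have hden : Tendsto (fun ω => (S.den m).eval ω) (𝓝[≠] a) (𝓝[≠] 0) := by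
    refine tendsto_nhdsWithin_of_tendsto_nhds_of_eventually_within _
      (((S.den m).continuous.tendsto' a 0 ha).mono_left nhdsWithin_le_nhds) ?_
    exact (S.eventually_isRegularAt a).mono fun ω hω => (hω m hm).2
  have hnum : Tendsto (fun ω => (S.num m).eval ω * (S.thickness m * ω / S.c) ^ 2) (𝓝[≠] a)
      (𝓝 ((S.num m).eval a * (S.thickness m * a / S.c) ^ 2)) :=
    (Continuous.tendsto (by fun_prop) a).mono_left nhdsWithin_le_nhds
  have hne : (S.num m).eval a * (S.thickness m * a / S.c) ^ 2 ≠ 0 :=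
    mul_ne_zero (S.eval_num_ne_zero_of_eval_den_eq_zero hm ha) (pow_ne_zero 2
      (div_ne_zero (mul_ne_zero hd (S.ne_zero_of_eval_den_eq_zero hm ha)) hc))
  refine (tendsto_cobounded_iff_meromorphicOrderAt_neg
    (S.meromorphicAt_evanescentPhase_sq m a)).1 (tendsto_norm_atTop_iff_cobounded.1 ?_)
  refine (hnum.norm.pos_mul_atTop (norm_pos_iff.2 hne) (tendsto_norm_cobounded_atTop.comp
    (tendsto_inv₀_nhdsNE_zero.comp hden))).congr fun ω => ?_
  rw [evanescentPhase_sq, indexSq, Function.comp_apply, Function.comp_apply, ← norm_mul]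
  ring_nf

/-- The direction `v` is such that all layers which are resonant at `a` are traversed by evanescent
waves at the frequencies `a + x * v`, as `x` decreases to `0`. -/
def IsAttenuating (a v : ℂ) : Prop :=
  v ≠ 0 ∧ ∀ m ≤ S.N + 1, (S.den m).eval a = 0 →
    S.IsEvanescent (𝓝[>] 0) (fun x : ℝ => (x : ℂ)⁻¹) (fun x => a + x * v) m

theorem exists_isAttenuating (a : ℂ) : ∃ v, S.IsAttenuating a v ∧ S.IsAttenuating a (-v) := by
  have hlead (m : {m : ℕ // m ≤ S.N + 1 ∧ (S.den m).eval a = 0}) :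
      ∃ n : ℤ, n < 0 ∧ ∃ g, AnalyticAt ℂ g a ∧ g a ≠ 0 ∧
        ∀ᶠ z in 𝓝[≠] a, S.evanescentPhase m z ^ 2 = (z - a) ^ n * g z := by
    have hneg := S.meromorphicOrderAt_evanescentPhase_sq_neg m.2.1 m.2.2
    obtain ⟨n, hn⟩ := WithTop.ne_top_iff_exists.1 hneg.ne_top
    rw [← hn] at hneg
    exact ⟨n, WithTop.coe_lt_zero.1 hneg, (meromorphicOrderAt_eq_int_iff
      (S.meromorphicAt_evanescentPhase_sq m a)).1 hn.symm⟩
  choose n hn g hg hga hphase using hlead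
  obtain ⟨v, hv, him⟩ := exists_forall_im_zpow_mul_ne_zero hga fun m => (hn m).ne
  have hatt {u : ℂ} (hu : u ≠ 0) (hu_im : ∀ m, (u ^ n m * g m a).im ≠ 0) : S.IsAttenuating a u :=
    ⟨hu, fun m hm ha => eventually_le_im_sq_ray (hphase ⟨m, hm, ha⟩) (hg _).continuousAt (hn _) hu
      (hu_im _)⟩
  exact ⟨v, hatt hv him, hatt (neg_ne_zero.2 hv) fun m => im_neg_zpow_mul_ne_zero (him m)⟩

/-- The layers `j + 1, …, j + q` are not resonant at `a`, and medium `j` is the half-space `0` or a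
layer which is resonant at `a`. -/
structure IsNonresonantBlock (a : ℂ) (j q : ℕ) : Prop where
  left : j = 0 ∨ (S.den j).eval a = 0
  eval_den_ne_zero : ∀ m, j < m → m ≤ j + q → (S.den m).eval a ≠ 0

variable {S} {a v : ℂ} {j q : ℕ}

theorem IsNonresonantBlock.distinct (h : S.IsNonresonantBlock a j q) (hq : j + q ≤ S.N)
    (hright : j + q = S.N ∨ (S.den (j + q + 1)).eval a = 0) (hlt : ¬(j = 0 ∧ q = S.N))
    (hadj : q = 0 → j = 0 ∨ j = S.N) :
    S.Distinct j (j + 1) ∧ S.Distinct (j + q) (j + q + 1) := by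
  rcases Nat.eq_zero_or_pos q with rfl | hpos
  · rcases hadj rfl with rfl | rfl
    · have h := S.distinct_layer_halfSpace (j := 1) (by lia) (by lia) (.inl rfl)
      exact ⟨h.symm, h.symm⟩
    · have h := S.distinct_layer_halfSpace (j := S.N) (by lia) (by lia) (.inr rfl)
      exact ⟨h, h⟩
  constructor
  · rcases h.left with rfl | ha
    · exact (S.distinct_layer_halfSpace (by lia) (by lia) (.inl rfl)).symm
    · exact S.distinct_of_den_eq_zero (by lia) ha (h.eval_den_ne_zero _ (by lia) (by lia))
  · rcases hright with hN | ha
    · exact S.distinct_layer_halfSpace (by lia) (by lia) (.inr (by lia))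
    · exact (S.distinct_of_den_eq_zero (by lia) ha (h.eval_den_ne_zero _ (by lia) le_rfl)).symm

variable (S) in
theorem polyBdd_layerChar_ray (hv : v ≠ 0) {m : ℕ} (ha : (S.den m).eval a ≠ 0) (b c : Fin 2) :
    PolyBdd (𝓝[>] 0) (fun x : ℝ => (x : ℂ)⁻¹) fun x => S.layerChar p (a + x * v) m b c :=
  polyBdd_ray_of_meromorphicAt (S.analyticAt_layerChar p ha b c).meromorphicAt hv

theorem polyInv_interfaceFactor_of_distinct (hv : v ≠ 0) (hq : j + q ≤ S.N)
    (hj : S.Distinct j (j + 1)) (hj' : S.Distinct (j + q) (j + q + 1))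
    (hden : ∀ m, j < m → m ≤ j + q → (S.den m).eval a ≠ 0) :
    PolyInv (𝓝[>] 0) (fun x : ℝ => (x : ℂ)⁻¹) fun x =>
      interfaceFactor (stackMatrix (S.layerChar p (a + x * v)) j q)
        (S.evanescentCoeff p j (a + x * v)) (S.evanescentCoeff p (j + q + 1) (a + x * v)) := by
  have hγ := isTamePath_ray hv a
  refine polyInv_interfaceFactor_of_signProd
    (polyBdd_stackMatrix fun m h₁ h₂ => S.polyBdd_layerChar_ray p hv (hden m h₁ h₂))
    (S.polyBdd_evanescentCoeff p hγ (by lia)) (S.polyInv_evanescentCoeff p hγ (by lia)).polyBdd_inv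
    ?_
  simp only [evanescentCoeff_sq]
  exact polyInv_ray_of_meromorphicAt (S.meromorphicAt_blockProd p hden) hv
    (not_eventually_blockProd_eq_zero p hq hj hj' a)

theorem IsAttenuating.polyInv_interfaceFactor (hv : S.IsAttenuating a v)
    (h : S.IsNonresonantBlock a j q) (hq : j + q ≤ S.N)
    (hright : j + q = S.N ∨ (S.den (j + q + 1)).eval a = 0) (hlt : ¬(j = 0 ∧ q = S.N)) :
    PolyInv (𝓝[>] 0) (fun x : ℝ => (x : ℂ)⁻¹) fun x =>
      interfaceFactor (stackMatrix (S.layerChar p (a + x * v)) j q)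
        (S.evanescentCoeff p j (a + x * v)) (S.evanescentCoeff p (j + q + 1) (a + x * v)) := by
  by_cases hadj : q = 0 → j = 0 ∨ j = S.N
  · obtain ⟨hj, hj'⟩ := h.distinct hq hright hlt hadj
    exact polyInv_interfaceFactor_of_distinct p hv.1 hq hj hj' h.eval_den_ne_zero
  · push Not at hadj
    obtain ⟨rfl, hj0, hjN⟩ := hadj
    simpa only [stackMatrix, interfaceFactor_one] using
      (hv.2 j (by lia) (h.left.resolve_left hj0)).polyInv_one_add p (isTamePath_ray hv.1 a)
        (by lia) (by lia) (j := j + 1) (by lia) (by lia)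

theorem IsAttenuating.exists_asympSMul_stackMatrix (hv : S.IsAttenuating a v) {m : ℕ}
    (hm : m ≤ S.N) : ∃ j q A, j + q = m ∧ S.IsNonresonantBlock a j q ∧
      (j ≠ 0 → SuperpolynomialDecay (𝓝[>] 0) (fun x : ℝ => (x : ℂ)⁻¹) fun x => (A x)⁻¹) ∧
      AsympSMul (𝓝[>] 0) (fun x : ℝ => (x : ℂ)⁻¹) A
        (fun x => stackMatrix (S.layerChar p (a + x * v)) j q *ᵥ
          ![1, S.evanescentCoeff p j (a + x * v)])
        (fun x => stackMatrix (S.layerChar p (a + x * v)) 0 m *ᵥ ![1, p.single S.nIn]) := by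
  have hγ := isTamePath_ray hv.1 a
  induction m with
  | zero =>
    refine ⟨0, 0, fun _ => 1, rfl, ⟨.inl rfl, by lia⟩, fun h => absurd rfl h, ?_⟩
    simpa only [evanescentCoeff_zero] using asympSMul_refl _
  | succ m ih =>
    obtain ⟨j, q, A, rfl, hblock, hA, hfield⟩ := ih (by lia)
    by_cases hres : (S.den (j + q + 1)).eval a = 0
    · have hev := hv.2 (j + q + 1) (by lia) hres
      have hB := hv.polyInv_interfaceFactor p hblock (by lia) (.inr hres) (by lia)
      have he := polyBdd_mulVec_vec_one
        (polyBdd_stackMatrix fun m h₁ h₂ =>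
          S.polyBdd_layerChar_ray p hv.1 (hblock.eval_den_ne_zero m h₁ h₂))
        (S.polyBdd_evanescentCoeff p hγ (by lia : j ≤ S.N + 1))
      have hstep := hev.asympSMul_layerChar p hγ (by lia) hm hfield he hB
      refine ⟨j + q + 1, 0, _, rfl, ⟨.inr hres, by lia⟩, fun _ =>
        hev.superpolynomialDecay_inv_layerGain p hγ (by lia) hm hfield.polyInv hB, ?_⟩
      simpa only [stackMatrix, Matrix.one_mulVec, ← Matrix.mulVec_mulVec, zero_add] using hstep
    · refine ⟨j, q + 1, A, rfl, ⟨hblock.left, fun k h₁ h₂ => ?_⟩, hA, ?_⟩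
      · rcases Nat.lt_or_ge k (j + q + 1) with hk | hk
        · exact hblock.eval_den_ne_zero k h₁ (by lia)
        · rwa [show k = j + q + 1 by lia]
      · simpa only [stackMatrix, ← Matrix.mulVec_mulVec, zero_add] using
          hfield.mulVec (S.polyBdd_layerChar_ray p hv.1 hres)

section Resonant

variable (hv : S.IsAttenuating a v) {m : ℕ} (h₁ : 1 ≤ m) (h₂ : m ≤ S.N)
  (ha : (S.den m).eval a = 0)

include hv h₁ h₂ ha

theorem IsAttenuating.exists_asympSMul_outField :
    ∃ A e, AsympSMul (𝓝[>] 0) (fun x : ℝ => (x : ℂ)⁻¹) A e (fun x => S.outField p (a + x * v)) ∧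
      PolyInv (𝓝[>] 0) (fun x : ℝ => (x : ℂ)⁻¹) (fun x => p.single S.nOut * e x 0 + 1 * e x 1) ∧
      SuperpolynomialDecay (𝓝[>] 0) (fun x : ℝ => (x : ℂ)⁻¹) fun x => (A x)⁻¹ := by
  obtain ⟨j, q, A, hjq, hblock, hA, hfield⟩ := hv.exists_asympSMul_stackMatrix p le_rfl
  have hj : j ≠ 0 := by
    rintro rfl
    exact hblock.eval_den_ne_zero m h₁ (by lia) ha
  refine ⟨A, _, hfield, ?_, hA hj⟩
  have hout : p.single S.nOut ≠ 0 := p.single_ne_zero (Complex.ofReal_ne_zero.2 S.nOut_pos.ne')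
  have hB := hv.polyInv_interfaceFactor p hblock hjq.le (.inl hjq) (by lia)
  simp only [hjq, evanescentCoeff_last] at hB
  refine ((polyInv_const hout).mul hB).congr' (.of_forall fun x => ?_)
  simp only [interfaceFactor]
  field_simp

theorem IsAttenuating.eventually_reducedDenom_ne_zero :
    ∀ᶠ x : ℝ in 𝓝[>] 0, S.reducedDenom p (a + x * v) ≠ 0 := by
  obtain ⟨A, e, h, hB, -⟩ := hv.exists_asympSMul_outField p h₁ h₂ ha
  refine (h.polyInv_linearCombination (polyBdd_const _) (polyBdd_const 1) hB).ne_zero.mono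
    fun x hx => ?_
  simpa only [reducedDenom, one_mul] using hx

theorem IsAttenuating.superpolynomialDecay_inv_reducedDenom :
    SuperpolynomialDecay (𝓝[>] 0) (fun x : ℝ => (x : ℂ)⁻¹)
      fun x => (S.reducedDenom p (a + x * v))⁻¹ := by
  obtain ⟨A, e, h, hB, hA⟩ := hv.exists_asympSMul_outField p h₁ h₂ ha
  refine (h.superpolynomialDecay_inv_linearCombination hA (polyBdd_const _) (polyBdd_const 1)
    hB).congr fun x => ?_
  simp only [reducedDenom, one_mul]

end Resonant

end LorentzStack

section ExpBdd

variable {f g : ℂ → ℂ} {a : ℂ}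

theorem expBdd_const (c a : ℂ) : ExpBdd (fun _ => c) a :=
  ⟨0, by simpa only [zero_div, Real.exp_zero] using isBigO_const_const c one_ne_zero _⟩

namespace ExpBdd

theorem of_isBigO (hg : ExpBdd g a) (h : f =O[𝓝[≠] a] g) : ExpBdd f a := by
  obtain ⟨C, hC⟩ := hg
  exact ⟨C, h.trans hC⟩

theorem mul (hf : ExpBdd f a) (hg : ExpBdd g a) : ExpBdd (fun ω => f ω * g ω) a := by
  obtain ⟨C, hC⟩ := hf
  obtain ⟨D, hD⟩ := hg
  exact ⟨C + D, by simpa only [add_div, Real.exp_add] using hC.mul hD⟩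

theorem add (hf : ExpBdd f a) (hg : ExpBdd g a) : ExpBdd (fun ω => f ω + g ω) a := by
  obtain ⟨C, hC⟩ := hf
  obtain ⟨D, hD⟩ := hg
  have hmono {B B' : ℝ} (h : B ≤ B') : (fun ω => Real.exp (B / ‖ω - a‖)) =O[𝓝[≠] a]
      fun ω => Real.exp (B' / ‖ω - a‖) :=
    .of_norm_le fun ω => by
      rw [Real.norm_of_nonneg (Real.exp_pos _).le]
      gcongr
  exact ⟨max C D, (hC.trans (hmono (le_max_left C D))).add (hD.trans (hmono (le_max_right C D)))⟩

end ExpBdd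

theorem expBdd_inv_sub_sq (a : ℂ) : ExpBdd (fun ω => ((ω - a) ^ 2)⁻¹) a := by
  have hinv : ExpBdd (fun ω => (ω - a)⁻¹) a := by
    refine ⟨1, .of_norm_le fun ω => ?_⟩
    rw [norm_inv, one_div]
    exact (le_add_of_nonneg_right zero_le_one).trans (Real.add_one_le_exp _)
  simpa only [← pow_two, inv_pow] using hinv.mul hinv

theorem expBdd_evenLift {F : ℂ → ℂ} (hF : ∀ z, ‖F z‖ ≤ Real.exp ‖z‖)
    (hf : f =O[𝓝[≠] a] fun ω => ((ω - a) ^ 2)⁻¹) : ExpBdd (fun ω => evenLift F (f ω)) a := by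
  obtain ⟨K, hK⟩ := hf.bound
  refine ⟨√K, IsBigO.of_norm_eventuallyLE ?_⟩
  filter_upwards [hK] with ω hω
  refine (hF _).trans (Real.exp_le_exp.2 ?_)
  rw [← Real.sqrt_sq (norm_nonneg (f ω ^ (2⁻¹ : ℂ))), ← norm_pow, cpow_inv_two_sq,
    ← Real.sqrt_sq (norm_nonneg (ω - a)), ← Real.sqrt_div' _ (sq_nonneg _)]
  rw [norm_inv, norm_pow, ← div_eq_mul_inv] at hω
  exact Real.sqrt_le_sqrt hω

theorem isBigO_eval_div_eval {P Q : Polynomial ℂ} {n : ℕ} (hQ : Q ≠ 0) (hn : Q.natDegree ≤ n)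
    (a : ℂ) : (fun ω => P.eval ω / Q.eval ω) =O[𝓝[≠] a] fun ω => ((ω - a) ^ n)⁻¹ := by
  obtain ⟨R, hR, hdvd⟩ := Polynomial.exists_eq_pow_rootMultiplicity_mul_and_not_dvd Q hQ a
  rw [Polynomial.dvd_iff_isRoot] at hdvd
  have hmult : Q.rootMultiplicity a ≤ n :=
    (Q.count_roots (a := a) ▸ Multiset.count_le_card a Q.roots).trans (Q.card_roots'.trans hn)
  obtain ⟨d, rfl⟩ := Nat.exists_eq_add_of_le hmult
  have hlim : Tendsto (fun ω => P.eval ω / R.eval ω * (ω - a) ^ d) (𝓝[≠] a)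
      (𝓝 (P.eval a / R.eval a * (a - a) ^ d)) :=
    (((P.continuous.tendsto a).div (R.continuous.tendsto a) hdvd).mul
      (Continuous.tendsto (by fun_prop) a)).mono_left nhdsWithin_le_nhds
  refine ((hlim.isBigO_one ℂ).mul (isBigO_refl (fun ω => ((ω - a) ^ _)⁻¹) _)).congr' ?_
    (.of_forall fun _ => one_mul _)
  filter_upwards [self_mem_nhdsWithin] with ω hω
  have hω' : ω - a ≠ 0 := sub_ne_zero.2 hω
  have hQω : Q.eval ω = (ω - a) ^ Q.rootMultiplicity a * R.eval ω := by
    conv_lhs => rw [hR]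
    rw [Polynomial.eval_mul, Polynomial.eval_pow, Polynomial.eval_sub, Polynomial.eval_X,
      Polynomial.eval_C]
  rw [hQω, pow_add]
  field_simp

theorem expBdd_charMatrix (p : Polarization) {w κ : ℂ → ℂ}
    (hw : w =O[𝓝[≠] a] fun ω => ((ω - a) ^ 2)⁻¹) (hκ : κ =O[𝓝[≠] a] fun _ => (1 : ℂ))
    (b c : Fin 2) : ExpBdd (fun ω => charMatrix p (w ω) (κ ω) b c) a := by
  have hprod : (fun ω => w ω * κ ω ^ 2) =O[𝓝[≠] a] fun ω => ((ω - a) ^ 2)⁻¹ := by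
    simpa using hw.mul (hκ.pow 2)
  have hcos := expBdd_evenLift norm_cos_le_exp_norm hprod
  have hsin := expBdd_evenLift norm_sinQuot_le_exp_norm hprod
  have hκ' := (expBdd_const 1 a).of_isBigO hκ
  have hκsin := (expBdd_const (-Complex.I) a).mul (hκ'.mul hsin)
  have hwκsin := (expBdd_const (-Complex.I) a).mul
    ((((expBdd_inv_sub_sq a).of_isBigO hw).mul hκ').mul hsin)
  cases p <;> fin_cases b <;> fin_cases c <;> first | exact hcos | exact hκsin | exact hwκsin

theorem expBdd_stackMatrix {M : ℂ → ℕ → Matrix (Fin 2) (Fin 2) ℂ} {j q : ℕ}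
    (h : ∀ m, j < m → m ≤ j + q → ∀ b c, ExpBdd (fun ω => M ω m b c) a) (b c : Fin 2) :
    ExpBdd (fun ω => stackMatrix (M ω) j q b c) a := by
  induction q generalizing b c with
  | zero => exact expBdd_const _ a
  | succ q ih =>
    have hlast := h (j + q + 1) (by lia) le_rfl
    have hrest := ih fun m h₁ h₂ => h m h₁ (by lia)
    simpa only [stackMatrix, Matrix.mul_apply, Fin.sum_univ_two] using
      ((hlast b 0).mul (hrest 0 c)).add ((hlast b 1).mul (hrest 1 c))

end ExpBdd

theorem tendsto_add_sq (a : ℂ) : Tendsto (fun t : ℂ => a + t ^ 2) (𝓝[≠] 0) (𝓝[≠] a) := by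
  refine tendsto_nhdsWithin_of_tendsto_nhds_of_eventually_within _
    ((Continuous.tendsto' (by fun_prop) _ _ (by simp)).mono_left nhdsWithin_le_nhds) ?_
  filter_upwards [self_mem_nhdsWithin] with t ht
  rw [Set.mem_compl_singleton_iff, ne_eq, add_eq_left]
  exact pow_ne_zero 2 ht

theorem exists_holomorphic_root {f : ℂ → ℂ} {a : ℂ} (hf : MeromorphicAt f a)
    (hne : ∀ᶠ ω in 𝓝[≠] a, f ω ≠ 0) :
    ∃ ρ : ℂ → ℂ, ∀ᶠ t in 𝓝[≠] (0 : ℂ), AnalyticAt ℂ ρ t ∧ ρ t ^ 2 = f (a + t ^ 2) := by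
  obtain ⟨g, hg, hga, hfg⟩ := (meromorphicOrderAt_ne_top_iff hf).1
    ((meromorphicOrderAt_ne_top_iff_eventually_ne_zero hf).2 hne)
  obtain ⟨k, hk⟩ : ∃ k, (meromorphicOrderAt f a).untop₀ = k := ⟨_, rfl⟩
  obtain ⟨r, hr, hr_sq⟩ := exists_analyticAt_sq_eq hga
  have hsub : AnalyticAt ℂ (fun t : ℂ => a + t ^ 2) 0 := by fun_prop
  have hroot : AnalyticAt ℂ (fun t : ℂ => r (g (a + t ^ 2))) 0 :=
    hr.comp_of_eq (hg.comp_of_eq hsub (by simp)) (by simp)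
  refine ⟨fun t => t ^ k * r (g (a + t ^ 2)), ?_⟩
  filter_upwards [nhdsWithin_le_nhds hroot.eventually_analyticAt,
    (tendsto_add_sq a).eventually hfg, self_mem_nhdsWithin] with t htroot htfg ht
  refine ⟨(analyticAt_id.zpow ht).mul htroot, ?_⟩
  rw [htfg, hk, mul_pow, hr_sq, add_sub_cancel_left, smul_eq_mul, ← zpow_natCast, ← zpow_natCast,
    ← _root_.zpow_mul, ← _root_.zpow_mul, mul_comm k]

theorem analyticAt_wolter {g δ : ℂ → ℕ → ℂ} {x : ℂ} {k : ℕ}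
    (hg : ∀ m, m ≤ k + 1 → AnalyticAt ℂ (fun z => g z m) x)
    (hδ : ∀ m, 1 ≤ m → m ≤ k → AnalyticAt ℂ (fun z => δ z m) x) :
    AnalyticAt ℂ (fun z => (wolter (g z) (δ z) k).1) x ∧
      AnalyticAt ℂ (fun z => (wolter (g z) (δ z) k).2) x := by
  induction k with
  | zero => exact ⟨(hg 1 le_rfl).fun_sub (hg 0 (by lia)), (hg 1 le_rfl).fun_add (hg 0 (by lia))⟩
  | succ k ih =>
    obtain ⟨hnum, hden⟩ := ih (fun m hm => hg m (by lia)) fun m hm hm' => hδ m hm (by lia)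
    have hleft := hg (k + 1) (by lia)
    have hright := hg (k + 2) (by lia)
    have hphase := hδ (k + 1) (by lia) le_rfl
    simp only [wolter]
    constructor <;> fun_prop

namespace LorentzStack

variable (S : LorentzStack) (p : Polarization)

theorem natDegree_den_le_two (m : ℕ) : (S.den m).natDegree ≤ 2 := by
  rw [den]
  split_ifs
  · simp
  · rw [lorentzPoly]
    compute_degree

theorem isBigO_indexSq {m : ℕ} (hm : m ≤ S.N + 1) (a : ℂ) :
    S.indexSq m =O[𝓝[≠] a] fun ω => ((ω - a) ^ 2)⁻¹ :=
  isBigO_eval_div_eval (S.den_ne_zero hm) (S.natDegree_den_le_two m) a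

theorem expBdd_layerChar {m : ℕ} (hm : m ≤ S.N + 1) (a : ℂ) (b c : Fin 2) :
    ExpBdd (fun ω => S.layerChar p ω m b c) a := by
  have hlim : Tendsto (fun ω : ℂ => S.thickness m * ω / S.c) (𝓝[≠] a)
      (𝓝 (S.thickness m * a / S.c : ℂ)) :=
    (Continuous.tendsto (by fun_prop) a).mono_left nhdsWithin_le_nhds
  exact expBdd_charMatrix p (S.isBigO_indexSq hm a) (hlim.isBigO_one ℂ) b c

theorem expBdd_reducedDenom (a : ℂ) : ExpBdd (S.reducedDenom p) a := by
  have hstack (b c : Fin 2) : ExpBdd (fun ω => stackMatrix (S.layerChar p ω) 0 S.N b c) a :=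
    expBdd_stackMatrix (fun m _ hm => S.expBdd_layerChar p (by lia) a) b c
  have hfield (b : Fin 2) : ExpBdd (fun ω => S.outField p ω b) a := by
    simpa [outField, Matrix.mulVec, dotProduct, Fin.sum_univ_two] using
      (hstack b 0).add ((hstack b 1).mul (expBdd_const (p.single S.nIn) a))
  exact ((expBdd_const _ a).mul (hfield 0)).add (hfield 1)

theorem exists_isHolomorphicBranch (a : ℂ) : ∃ ν, S.IsHolomorphicBranch a ν := by
  have hroot (m : ℕ) (hm : m ≤ S.N + 1) :=
    exists_holomorphic_root (S.meromorphicAt_indexSq m a)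
      ((S.eventually_isRegularAt a).mono fun _ h => h.indexSq_ne_zero hm)
  choose! ρ hρ using hroot
  refine ⟨fun t m => if m = 0 then S.nIn else if m = S.N + 1 then S.nOut else ρ m t, ?_⟩
  have hall : ∀ᶠ t in 𝓝[≠] (0 : ℂ), ∀ m ∈ Set.Icc 1 S.N,
      AnalyticAt ℂ (ρ m) t ∧ ρ m t ^ 2 = S.indexSq m (a + t ^ 2) :=
    (eventually_all_finite (Set.finite_Icc 1 S.N)).2 fun m hm => hρ m (by grind)
  have hlayer (t : ℂ) {m : ℕ} (h₁ : 1 ≤ m) (h₂ : m ≤ S.N) : (if m = 0 then (S.nIn : ℂ) else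
      if m = S.N + 1 then (S.nOut : ℂ) else ρ m t) = ρ m t := by
    rw [if_neg (by lia), if_neg (by lia)]
  refine hall.mono fun t ht => ⟨⟨by simp, by simp, fun m h₁ h₂ hden => ?_⟩, fun m h₁ h₂ => ?_⟩
  · simp only [hlayer t h₁ h₂]
    rw [(ht m ⟨h₁, h₂⟩).2, S.indexSq_layer h₁ h₂ hden]
  · simpa only [hlayer _ h₁ h₂] using (ht m ⟨h₁, h₂⟩).1

end LorentzStack

section Meromorphic

variable {f : ℂ → ℂ} {a v : ℂ}

theorem not_meromorphicAt_of_superpolynomialDecay_inv (hv : v ≠ 0)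
    (hne : ∀ᶠ x : ℝ in 𝓝[>] 0, f (a + x * v) ≠ 0)
    (hdec : SuperpolynomialDecay (𝓝[>] 0) (fun x : ℝ => (x : ℂ)⁻¹) fun x => (f (a + x * v))⁻¹) :
    ¬ MeromorphicAt f a := by
  intro hf
  have hlim := tendsto_zero_of_superpolynomialDecay
    ((polyBdd_ray_of_meromorphicAt hf hv).mul_superpolynomialDecay hdec)
  exact one_ne_zero (tendsto_nhds_unique ((tendsto_const_nhds (x := (1 : ℂ))).congr'
    (hne.mono fun _ h => (mul_inv_cancel₀ h).symm)) hlim)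

theorem meromorphicAt_of_polyBdd (hd : ∀ᶠ z in 𝓝[≠] a, DifferentiableAt ℂ f z)
    (hf : PolyBdd (𝓝[≠] a) (fun z => (z - a)⁻¹) f) : MeromorphicAt f a := by
  obtain ⟨m, hm⟩ := hf
  have hbdd : Tendsto (fun z => (‖z - a‖ + 1) ^ m) (𝓝[≠] a) (𝓝 ((‖a - a‖ + 1) ^ m)) :=
    (Continuous.tendsto (by fun_prop) a).mono_left nhdsWithin_le_nhds
  have hO : (fun z => (z - a) ^ m * f z) =O[𝓝[≠] a] fun _ => (1 : ℂ) := by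
    refine (((isBigO_refl (fun z => (z - a) ^ m) _).norm_right.mul hm).trans_eventuallyEq ?_).trans
      (hbdd.isBigO_one ℂ)
    filter_upwards [self_mem_nhdsWithin] with z hz
    rw [norm_pow, ← mul_pow, norm_inv, mul_add, mul_one,
      mul_inv_cancel₀ (norm_ne_zero_iff.2 (sub_ne_zero.2 hz))]
  obtain ⟨Q, hQ, hQf⟩ := exists_analyticAt_eventuallyEq_of_isBigO_one
    (hd.mono fun z hz => DifferentiableAt.fun_mul (by fun_prop) hz) hO
  have hsub : MeromorphicAt (fun z => ((z - a) ^ m)⁻¹) a := by fun_prop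
  refine (hsub.fun_mul hQ.meromorphicAt).congr ?_
  filter_upwards [hQf, self_mem_nhdsWithin] with z hz hza
  rw [hz, inv_mul_cancel_left₀ (pow_ne_zero m (sub_ne_zero.2 hza))]

theorem meromorphicAt_of_comp_add_sq (hd : ∀ᶠ z in 𝓝[≠] a, DifferentiableAt ℂ f z)
    (hf : MeromorphicAt (fun t => f (a + t ^ 2)) 0) : MeromorphicAt f a := by
  have hroot : Tendsto (fun z => (z - a) ^ (2⁻¹ : ℂ)) (𝓝[≠] a) (𝓝[≠] 0) := by
    refine tendsto_nhdsWithin_of_tendsto_nhds_of_eventually_within _ ?_ ?_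
    · have hcont : ContinuousAt (fun w : ℂ => w ^ (2⁻¹ : ℂ)) (a - a) :=
        Complex.continuousAt_cpow_const_of_re_pos (by simp) (by norm_num)
      simpa [Function.comp_def] using
        (hcont.tendsto.comp ((continuous_sub_right a).tendsto a)).mono_left nhdsWithin_le_nhds
    · filter_upwards [self_mem_nhdsWithin] with z hz
      rw [Set.mem_compl_singleton_iff, ← pow_ne_zero_iff two_ne_zero, cpow_inv_two_sq]
      exact sub_ne_zero.2 hz
  have hparam : PolyBdd (𝓝[≠] a) (fun z => (z - a)⁻¹)
      fun z => ((z - a) ^ (2⁻¹ : ℂ) - 0)⁻¹ := by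
    refine .of_sq ?_
    simpa only [sub_zero, inv_pow, cpow_inv_two_sq] using polyBdd_param
  refine meromorphicAt_of_polyBdd hd ?_
  simpa only [cpow_inv_two_sq, add_sub_cancel] using
    ((polyBdd_of_meromorphicAt hf).comp hroot).mono_param hparam

end Meromorphic

namespace LorentzStack

variable {S : LorentzStack} (p : Polarization) {n : ℂ → ℕ → ℂ} {j : ℕ} {a : ℂ}

theorem IsResonance.eval_den_eq_zero (h : S.IsResonance j a) : (S.den j).eval a = 0 := by
  rw [S.eval_den_layer h.1 h.2.1, h.2.2]

theorem eventually_differentiableAt_prefactor_mul (S : LorentzStack) (a : ℂ) :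
    ∀ᶠ ω in 𝓝[≠] a,
      DifferentiableAt ℂ (fun ω => S.prefactor p ω * S.reducedDenom p ω ^ 2) ω :=
  (S.eventually_isRegularAt a).mono fun _ h =>
    ((h.analyticAt_prefactor p).fun_mul ((h.analyticAt_reducedDenom p).fun_pow 2)).differentiableAt

theorem IsResonance.not_meromorphicAt_prefactor_mul (h : S.IsResonance j a) :
    ¬ MeromorphicAt (fun ω => S.prefactor p ω * S.reducedDenom p ω ^ 2) a := by
  obtain ⟨v, hv, -⟩ := S.exists_isAttenuating a
  have hdec := hv.superpolynomialDecay_inv_reducedDenom p h.1 h.2.1 h.eval_den_eq_zero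
  refine not_meromorphicAt_of_superpolynomialDecay_inv hv.1 ?_ ?_
  · filter_upwards [(tendsto_add_ofReal_mul_nhdsNE hv.1 a).eventually (S.eventually_isRegularAt a),
      hv.eventually_reducedDenom_ne_zero p h.1 h.2.1 h.eval_den_eq_zero] with x hreg hne
    exact mul_ne_zero (hreg.prefactor_ne_zero p) (pow_ne_zero 2 hne)
  · simpa only [mul_inv, inv_pow, pow_two] using
      (polyBdd_ray_of_meromorphicAt (S.meromorphicAt_prefactor p a).fun_inv hv.1)
        |>.mul_superpolynomialDecay <|
          (polyBdd_of_superpolynomialDecay hdec).mul_superpolynomialDecay hdec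

section Denominator

variable (hn : ∀ ω, S.IsIndexAt ω (n ω))

include hn

theorem denominator_sq_eventuallyEq (a : ℂ) : (fun ω => S.denominator p ω (n ω) ^ 2) =ᶠ[𝓝[≠] a]
    fun ω => S.prefactor p ω * S.reducedDenom p ω ^ 2 :=
  (S.eventually_isRegularAt a).mono fun ω hω => (hn ω).denominator_sq_eq p hω

theorem IsRegularAt.analyticAt_denominator_sq {ω : ℂ} (hω : S.IsRegularAt ω) :
    AnalyticAt ℂ (fun ω => S.denominator p ω (n ω) ^ 2) ω :=
  ((hω.analyticAt_prefactor p).fun_mul ((hω.analyticAt_reducedDenom p).fun_pow 2)).congr <|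
    (S.isOpen_setOf_isRegularAt.eventually_mem hω).mono fun z hz =>
      ((hn z).denominator_sq_eq p hz).symm

theorem meromorphicAt_denominator_sq (ha : ∀ j, ¬ S.IsResonance j a) :
    MeromorphicAt (fun ω => S.denominator p ω (n ω) ^ 2) a := by
  have hreduced : AnalyticAt ℂ (S.reducedDenom p) a :=
    S.analyticAt_reducedDenom p fun m h₁ h₂ h =>
      ha m ⟨h₁, h₂, by rwa [S.eval_den_layer h₁ h₂] at h⟩
  exact ((S.meromorphicAt_prefactor p a).fun_mul (hreduced.meromorphicAt.fun_pow 2)).congr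
    (denominator_sq_eventuallyEq p hn a).symm

theorem IsResonance.isEssentialSingularity_denominator_sq (h : S.IsResonance j a) :
    IsEssentialSingularity (fun ω => S.denominator p ω (n ω) ^ 2) a :=
  ⟨(S.eventually_isRegularAt a).mono fun _ hω => hω.analyticAt_denominator_sq p hn,
    fun hm => h.not_meromorphicAt_prefactor_mul p
      (hm.congr (denominator_sq_eventuallyEq p hn a))⟩

theorem IsResonance.infinite_naturalModes (h : S.IsResonance j a) {U : Set ℂ} (hU : U ∈ 𝓝 a) :
    {ω | ω ∈ U ∧ S.IsNaturalMode p n ω}.Infinite := by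
  intro hfin
  obtain ⟨v, hv, hv'⟩ := S.exists_isAttenuating a
  have hzero : ∃ᶠ ω in 𝓝[≠] a, S.reducedDenom p ω = 0 :=
    frequently_eq_zero_of_superpolynomialDecay_inv hv.1
      ((S.eventually_isRegularAt a).mono fun _ hω => hω.analyticAt_reducedDenom p)
      (S.expBdd_reducedDenom p a)
      (hv.superpolynomialDecay_inv_reducedDenom p h.1 h.2.1 h.eval_den_eq_zero)
      (hv'.superpolynomialDecay_inv_reducedDenom p h.1 h.2.1 h.eval_den_eq_zero)
  refine hzero ?_
  filter_upwards [hfin.eventually_cofinite_notMem.filter_mono (nhdsNE_le_cofinite a),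
    nhdsWithin_le_nhds hU, S.eventually_isRegularAt a] with ω hmode hωU hω hωzero
  refine hmode ⟨hωU, fun m h₁ h₂ => ⟨?_, (hn ω).ne_zero hω h₁ h₂⟩, ?_⟩
  · simpa only [S.eval_den_layer h₁ h₂] using (hω m (by lia)).2
  · rw [(hn ω).denominator_eq p hω, hωzero, mul_zero]

end Denominator

section Branch

variable {ν : ℂ → ℕ → ℂ} (hν : S.IsHolomorphicBranch a ν)

include hν

theorem IsHolomorphicBranch.analyticAt_denominator : ∀ᶠ t in 𝓝[≠] (0 : ℂ),
    AnalyticAt ℂ (fun t => S.denominator p (a + t ^ 2) (ν t)) t := by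
  have hpunctured := eventually_eventually_nhdsWithin.2 hν
  filter_upwards [hν, hpunctured, self_mem_nhdsWithin,
    (tendsto_add_sq a).eventually (S.eventually_isRegularAt a)] with t ht hnear ht0 hreg
  replace hnear : ∀ᶠ s in 𝓝 t, S.IsIndexAt (a + s ^ 2) (ν s) := by
    rw [← isOpen_compl_singleton.nhdsWithin_eq ht0]
    exact hnear.mono fun s hs => hs.1
  have hcoeff (m : ℕ) (hm : m ≤ S.N + 1) : AnalyticAt ℂ (fun s => p.coeff (ν s) m) t := by
    simp only [p.coeff_eq_single]
    rcases eq_or_ne m 0 with rfl | h₀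
    · exact (analyticAt_const (v := p.single S.nIn)).congr
        (hnear.mono fun s hs => by simp only [hs.left])
    rcases eq_or_ne m (S.N + 1) with rfl | hN
    · exact (analyticAt_const (v := p.single S.nOut)).congr
        (hnear.mono fun s hs => by simp only [hs.right])
    exact p.analyticAt_single (ht.2 m (by lia) (by lia)) (ht.1.ne_zero hreg (by lia) (by lia))
  refine (analyticAt_wolter (g := fun s => p.coeff (ν s))
    (δ := fun s => S.phase (a + s ^ 2) (ν s)) hcoeff fun m h₁ h₂ => ?_).2
  exact (((ht.2 m h₁ h₂).fun_mul analyticAt_const).fun_mul (by fun_prop)).fun_div analyticAt_const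
    (Complex.ofReal_ne_zero.2 S.c_pos.ne')

theorem IsHolomorphicBranch.isEssentialSingularity_denominator (h : S.IsResonance j a) :
    IsEssentialSingularity (fun t => S.denominator p (a + t ^ 2) (ν t)) 0 := by
  refine ⟨hν.analyticAt_denominator p, fun hm => h.not_meromorphicAt_prefactor_mul p ?_⟩
  refine meromorphicAt_of_comp_add_sq (S.eventually_differentiableAt_prefactor_mul p a)
    ((hm.fun_pow 2).congr ?_)
  filter_upwards [hν, (tendsto_add_sq a).eventually (S.eventually_isRegularAt a)] with t ht hreg
  exact ht.1.denominator_sq_eq p hreg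

end Branch

end LorentzStack

theorem mainTheorem1 (S : LorentzStack) (p : Polarization)
    (n : ℂ → ℕ → ℂ) (hn : ∀ ω, S.IsIndexAt ω (n ω)) :
    (∀ (j : ℕ) (a : ℂ), S.IsResonance j a →
      IsEssentialSingularity (fun ω => S.denominator p ω (n ω) ^ 2) a ∧
      (∃ ν, S.IsHolomorphicBranch a ν) ∧
      (∀ ν, S.IsHolomorphicBranch a ν →
        IsEssentialSingularity (fun t => S.denominator p (a + t ^ 2) (ν t)) 0) ∧
      ∀ U ∈ 𝓝 a, {ω | ω ∈ U ∧ S.IsNaturalMode p n ω}.Infinite) ∧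
    (∀ a : ℂ, (∀ j, ¬ S.IsResonance j a) →
      MeromorphicAt (fun ω => S.denominator p ω (n ω) ^ 2) a) :=
  ⟨fun _ a h => ⟨h.isEssentialSingularity_denominator_sq p hn, S.exists_isHolomorphicBranch a,
      fun _ hν => hν.isEssentialSingularity_denominator p h,
      fun _ hU => h.infinite_naturalModes p hn hU⟩,
    fun _ ha => LorentzStack.meromorphicAt_denominator_sq p hn ha⟩
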